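/- Let $(\Omega,\Sigma,\mathbb P)$ be a probability space with a dyadic filtration $(\Sigma_k)_{k\ge 0}$, i.e. an increasing sequence of sub-$\sigma$-algebras of $\Sigma$ such that each $\Sigma_k$ is atomic with precisely $2^k$ atoms (up to null sets), each of probability $2^{-k}$. For $f\in L_1(\Omega)$ (complex valued) and $k\ge 1$ put $\Delta_k f=\mathbb E(f\mid\Sigma_k)-\mathbb E(f\mid\Sigma_{k-1})$. For a complex $M\times N$ matrix $A=(a_{jk})$ and $f\in L_1(\Omega)$ let $$ T_A^{*}f=\max_{1\le j\le M}\Big|\sum_{k=1}^N a_{jk}\Delta_k f\Big| . $$ For $1\le p<\infty$ let $h_p(A)$ and $h_p^w(A)$ be the least constants such that $$\|T_A^{*}f\|_{L_p}\le h_p(A)\|f\|_{L_p},\qquad \|T_A^{*}f\|_{L_{p,\infty}}\le h_p^w(A)\|f\|_{L_p}\qquad\text{for all } f\in L_p(\Omega),$$ where $\|g\|_{L_{p,\infty}}=\sup_{\lambda>0}\lambda\,\mathbb P(|g|>\lambda)^{1/p}$; for $1\le p<\infty$ and $0<q<p$ let $h_{p,q}(A)$ be the least constant such that $\|T_A^{*}f\|_{L_q}\le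 h_{p,q}(A)\|f\|_{L_p}$ for all $f\in L_p(\Omega)$. Write $h(A)=h_2(A)$. These constants are finite and do not depend on the choice of the probability space and of the dyadic filtration. Moreover: (i) If $1<p,q<\infty$, then there is a constant $0<C=C(p,q)<\infty$ such that for all $M,N$ and all complex $M\times N$ matrices $A$ $$\frac1C\,h_p(A)\le h_q^w(A)\le h_q(A)\le C\,h_p(A).$$ (ii) If $0<q<p$ and $1<p<\infty$, then there is a constant $0<C=C(p,q)<\infty$ such that for all $M,N$ and all complex $M\times N$ matrices $A$ $$\frac1C\,h(A)\le h_{p,q}(A)\le C\,h(A).$$ -/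

import Mathlib

open MeasureTheory
open scoped ENNReal NNReal

universe u v

/-- A sub-σ-algebra `𝒜` is atomic with precisely `n` atoms (up to null sets), each of probability
`n⁻¹`: there are `n` pairwise disjoint sets of `𝒜` of probability `n⁻¹`, and each of them is an
atom, i.e. has no subset in `𝒜` of strictly intermediate probability. As the probabilities of these
atoms add up to one, every atom of `𝒜` agrees with one of them up to a null set. -/
def HasEqualAtoms {Ω : Type u} {m : MeasurableSpace Ω} (P : Measure Ω)
    (𝒜 : MeasurableSpace Ω) (n : ℕ) : Prop :=
  ∃ a : Fin n → Set Ω,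
    Pairwise (fun i i' => Disjoint (a i) (a i')) ∧
    ∀ i, MeasurableSet[𝒜] (a i) ∧ P (a i) = (n : ℝ≥0∞)⁻¹ ∧
      ∀ B : Set Ω, MeasurableSet[𝒜] B → B ⊆ a i → P B = 0 ∨ P B = P (a i)

/-- A probability space with a dyadic filtration `(Σ_k)_{k ≥ 0}`: `Σ_k` has precisely `2 ^ k` atoms,
each of probability `2 ^ (-k)`. -/
structure DyadicSpace : Type (u + 1) where
  Ω : Type u
  [mΩ : MeasurableSpace Ω]
  P : Measure Ω
  [isProb : IsProbabilityMeasure P]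
  filt : Filtration ℕ mΩ
  dyadic : ∀ k : ℕ, HasEqualAtoms P (filt k) (2 ^ k)

attribute [instance] DyadicSpace.mΩ DyadicSpace.isProb

/-- The weak `L_p` quasi-norm `sup_{t > 0} t * P(|g| > t) ^ (1 / p)`. -/
noncomputable def weakNorm {Ω : Type u} {m : MeasurableSpace Ω} (P : Measure Ω) (p : ℝ)
    (g : Ω → ℝ) : ℝ≥0∞ :=
  ⨆ t : ℝ≥0, (t : ℝ≥0∞) * P {ω | (t : ℝ) < |g ω|} ^ (1 / p)

namespace DyadicSpace

/-- The martingale difference `E(f | Σ_k) - E(f | Σ_{k-1})`, used for `k ≥ 1`. -/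
noncomputable def delta (X : DyadicSpace.{u}) (k : ℕ) (f : X.Ω → ℂ) : X.Ω → ℂ :=
  X.P[f | X.filt k] - X.P[f | X.filt (k - 1)]

/-- The maximal function `max_j |∑_k a_{jk} Δ_k f|`: the norm of `Fin M → ℂ` is the maximum norm.
The indices `k = 1, …, N` are shifted to `0, …, N - 1`. -/
noncomputable def maximal (X : DyadicSpace.{u}) {M N : ℕ} (A : Matrix (Fin M) (Fin N) ℂ)
    (f : X.Ω → ℂ) : X.Ω → ℝ :=
  fun ω => ‖fun j : Fin M => ∑ k : Fin N, A j k * X.delta ((k : ℕ) + 1) f ω‖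

/-- `h_p(A)`: the least constant in the strong type `(p, p)` inequality. -/
noncomputable def strongConst (X : DyadicSpace.{u}) (p : ℝ) {M N : ℕ}
    (A : Matrix (Fin M) (Fin N) ℂ) : ℝ≥0∞ :=
  sInf {c : ℝ≥0∞ | ∀ f : X.Ω → ℂ, MemLp f (ENNReal.ofReal p) X.P →
    eLpNorm (X.maximal A f) (ENNReal.ofReal p) X.P ≤ c * eLpNorm f (ENNReal.ofReal p) X.P}

/-- `h_p^w(A)`: the least constant in the weak type `(p, p)` inequality. -/
noncomputable def weakConst (X : DyadicSpace.{u}) (p : ℝ) {M N : ℕ}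
    (A : Matrix (Fin M) (Fin N) ℂ) : ℝ≥0∞ :=
  sInf {c : ℝ≥0∞ | ∀ f : X.Ω → ℂ, MemLp f (ENNReal.ofReal p) X.P →
    weakNorm X.P p (X.maximal A f) ≤ c * eLpNorm f (ENNReal.ofReal p) X.P}

/-- `h_{p,q}(A)`: the least constant in the `L_p → L_q` inequality. -/
noncomputable def mixedConst (X : DyadicSpace.{u}) (p q : ℝ) {M N : ℕ}
    (A : Matrix (Fin M) (Fin N) ℂ) : ℝ≥0∞ :=
  sInf {c : ℝ≥0∞ | ∀ f : X.Ω → ℂ, MemLp f (ENNReal.ofReal p) X.P →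
    eLpNorm (X.maximal A f) (ENNReal.ofReal q) X.P ≤ c * eLpNorm f (ENNReal.ofReal p) X.P}

end DyadicSpace

/-! Everything takes place on the cube `Fin N → Bool` with uniform measure. A dyadic filtration
carries fair coordinates whose first `k` ones generate `Σ_k` up to null sets, and the maximal
function depends on `f` only through `E(f | Σ_N)`, a function of `N` coordinates whose `L_p` norm is
at most that of `f`. So each constant equals one defined on the cube (`forall_maximal_le_iff`),
which gives independence of the space. Finiteness is a crude bound depending on `A`.

The maximum over `j` is the norm of `Fin M → ℂ`. Hence the maximal function is the norm of a
martingale transform whose coefficients are the columns of `A`, and the argument works in any normed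
space, with constants that depend on neither dimension nor size.

The equivalences come from one extrapolation (`eLpNorm_cubeTransform_le`): a weak `L_q` bound with
any `q > 0`, tested only on functions bounded by one, implies the strong `L_r` bound for every `r >
1`. Chebyshev turns the weak bound into a tail bound: the transform exceeds `K` with probability at
most a small `δ`. This localizes to subcubes, and applying it to `F` started and stopped at suitable
times gives a good-`λ` inequality (`good_lambda`) between the maximal transform and Doob's maximal
function. Integrating, absorbing the first term and using `doob_maximal` yields the strong bound.
Weak and mixed constants are trivially dominated by strong ones and control bounded functions, so
they all compare. -/

/-! ### Conditional expectations on the discrete cube -/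

section Cube

variable {N : ℕ} {V : Type*} [NormedAddCommGroup V] [NormedSpace ℝ V]

/-- The point of the cube with the first `n` coordinates of `w` and the other ones of `v`. -/
def cubeMerge (n : ℕ) (w v : Fin N → Bool) : Fin N → Bool :=
  fun i => if (i : ℕ) < n then w i else v i

/-- The mean of a function on the cube. -/
noncomputable def cubeMean (F : (Fin N → Bool) → V) : V :=
  ((2 : ℝ) ^ N)⁻¹ • ∑ w, F w

/-- The conditional expectation given the first `n` coordinates. -/
noncomputable def cubeExp (n : ℕ) (F : (Fin N → Bool) → V) (w : Fin N → Bool) : V :=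
  cubeMean fun v => F (cubeMerge n w v)

/-- `F` depends only on the first `n` coordinates. -/
def CubeDetermined {α : Type*} (n : ℕ) (F : (Fin N → Bool) → α) : Prop :=
  ∀ w v, F (cubeMerge n w v) = F w

lemma cubeMerge_merge_of_le {m n : ℕ} (h : m ≤ n) (w v z : Fin N → Bool) :
    cubeMerge m (cubeMerge n w v) z = cubeMerge m w z := by
  funext i
  simp only [cubeMerge]
  split_ifs <;> first | rfl | omega

lemma cubeMerge_merge_of_ge {m n : ℕ} (h : n ≤ m) (w v z : Fin N → Bool) :
    cubeMerge m (cubeMerge n w v) z = cubeMerge n w (cubeMerge m v z) := by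
  funext i
  simp only [cubeMerge]
  split_ifs <;> first | rfl | omega

/-- Exchanging the tails of two points is an involution on pairs of points; this is what proves the
tower property. -/
lemma cubeMerge_self_swap (n : ℕ) (w v : Fin N → Bool) :
    cubeMerge n (cubeMerge n w v) (cubeMerge n v w) = w := by
  funext i
  simp only [cubeMerge]
  split_ifs <;> rfl

lemma cubeMerge_of_ge {n : ℕ} (h : N ≤ n) (w v : Fin N → Bool) : cubeMerge n w v = w := by
  funext i
  simp only [cubeMerge]
  rw [if_pos (by omega)]

lemma cubeMerge_zero (w v : Fin N → Bool) : cubeMerge 0 w v = v := by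
  funext i
  simp [cubeMerge]

lemma card_cube (N : ℕ) : (Finset.univ : Finset (Fin N → Bool)).card = 2 ^ N := by simp

lemma cubeMean_const (c : V) : cubeMean (fun _ : Fin N → Bool => c) = c := by
  simp only [cubeMean, Finset.sum_const, card_cube]
  rw [← Nat.cast_smul_eq_nsmul ℝ, smul_smul]
  simp

lemma cubeMean_add (F G : (Fin N → Bool) → V) :
    cubeMean (fun w => F w + G w) = cubeMean F + cubeMean G := by
  simp [cubeMean, Finset.sum_add_distrib]

lemma cubeMean_sub (F G : (Fin N → Bool) → V) :
    cubeMean (fun w => F w - G w) = cubeMean F - cubeMean G := by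
  simp [cubeMean, Finset.sum_sub_distrib, smul_sub]

lemma cubeMean_sum {ι : Type*} (s : Finset ι) (F : ι → (Fin N → Bool) → V) :
    cubeMean (fun w => ∑ i ∈ s, F i w) = ∑ i ∈ s, cubeMean (F i) := by
  simp only [cubeMean, ← Finset.smul_sum]
  rw [Finset.sum_comm]

lemma cubeMean_smul {𝕜 : Type*} [NormedField 𝕜] [NormedSpace 𝕜 V] [SMulCommClass ℝ 𝕜 V]
    (c : 𝕜) (F : (Fin N → Bool) → V) :
    cubeMean (fun w => c • F w) = c • cubeMean F := by
  simp only [cubeMean, ← Finset.smul_sum]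
  rw [smul_comm]

lemma cubeMean_mono {F G : (Fin N → Bool) → ℝ} (h : ∀ w, F w ≤ G w) :
    cubeMean F ≤ cubeMean G := by
  simp only [cubeMean, smul_eq_mul]
  gcongr
  exact h _

lemma cubeMean_nonneg {F : (Fin N → Bool) → ℝ} (h : ∀ w, 0 ≤ F w) : 0 ≤ cubeMean F := by
  simpa [cubeMean_const] using cubeMean_mono (F := fun _ => (0 : ℝ)) h

lemma norm_cubeMean_le (F : (Fin N → Bool) → V) :
    ‖cubeMean F‖ ≤ cubeMean fun w => ‖F w‖ := by
  simp only [cubeMean, norm_smul, smul_eq_mul, norm_inv, norm_pow, Real.norm_ofNat]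
  gcongr
  exact norm_sum_le _ _

/-- The tower property for the conditional expectations and the mean. -/
lemma cubeMean_cubeExp (n : ℕ) (F : (Fin N → Bool) → V) : cubeMean (cubeExp n F) = cubeMean F := by
  have key : ∑ x : (Fin N → Bool) × (Fin N → Bool), F (cubeMerge n x.1 x.2)
      = ∑ x : (Fin N → Bool) × (Fin N → Bool), F x.1 :=
    Finset.sum_bij' (fun x _ => (cubeMerge n x.1 x.2, cubeMerge n x.2 x.1))
      (fun x _ => (cubeMerge n x.1 x.2, cubeMerge n x.2 x.1)) (by simp) (by simp)
      (by simp [cubeMerge_self_swap]) (by simp [cubeMerge_self_swap]) (by simp)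
  rw [Fintype.sum_prod_type, Fintype.sum_prod_type] at key
  have h : cubeMean (cubeExp n F) = cubeMean fun w => cubeMean fun _ : Fin N → Bool => F w := by
    unfold cubeExp
    simp only [cubeMean, ← Finset.smul_sum]
    rw [key]
  rw [h]
  simp only [cubeMean_const]

lemma cubeExp_determined (n : ℕ) (F : (Fin N → Bool) → V) : CubeDetermined n (cubeExp n F) := by
  intro w v
  simp only [cubeExp, cubeMerge_merge_of_le le_rfl]

lemma CubeDetermined.mono {α : Type*} {m n : ℕ} (h : m ≤ n) {F : (Fin N → Bool) → α}
    (hF : CubeDetermined m F) : CubeDetermined n F := by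
  intro w v
  rw [← hF (cubeMerge n w v) v, cubeMerge_merge_of_le h, hF]

lemma CubeDetermined.comp {α β : Type*} {n : ℕ} {F : (Fin N → Bool) → α}
    (hF : CubeDetermined n F) (g : α → β) : CubeDetermined n fun w => g (F w) := by
  intro w v
  simp only [hF w v]

lemma cubeDetermined_of_ge {α : Type*} {n : ℕ} (h : N ≤ n) (F : (Fin N → Bool) → α) :
    CubeDetermined n F := by
  intro w v
  rw [cubeMerge_of_ge h]

lemma CubeDetermined.cubeExp_smul {𝕜 : Type*} [NormedField 𝕜] [NormedSpace 𝕜 V]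
    [SMulCommClass ℝ 𝕜 V] {n : ℕ} {G : (Fin N → Bool) → 𝕜} (hG : CubeDetermined n G)
    (F : (Fin N → Bool) → V) (w : Fin N → Bool) :
    cubeExp n (fun v => G v • F v) w = G w • cubeExp n F w := by
  simp only [cubeExp, hG w, cubeMean_smul]

lemma CubeDetermined.cubeExp_eq {n : ℕ} {F : (Fin N → Bool) → V} (hF : CubeDetermined n F)
    (w : Fin N → Bool) : cubeExp n F w = F w := by
  simp only [cubeExp, hF w, cubeMean_const]

lemma cubeExp_of_ge {n : ℕ} (h : N ≤ n) (F : (Fin N → Bool) → V) (w : Fin N → Bool) :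
    cubeExp n F w = F w :=
  (cubeDetermined_of_ge h F).cubeExp_eq w

lemma cubeExp_cubeExp_of_le {m n : ℕ} (h : n ≤ m) (F : (Fin N → Bool) → V) (w : Fin N → Bool) :
    cubeExp n (cubeExp m F) w = cubeExp n F w := by
  rw [cubeExp, cubeExp, ← cubeMean_cubeExp m fun v => F (cubeMerge n w v)]
  simp only [cubeExp, cubeMerge_merge_of_ge h]
  rfl

lemma cubeExp_sub (n : ℕ) (F G : (Fin N → Bool) → V) (w : Fin N → Bool) :
    cubeExp n (fun v => F v - G v) w = cubeExp n F w - cubeExp n G w :=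
  cubeMean_sub _ _

lemma cubeExp_sum {ι : Type*} (n : ℕ) (s : Finset ι) (F : ι → (Fin N → Bool) → V)
    (w : Fin N → Bool) : cubeExp n (fun v => ∑ i ∈ s, F i v) w = ∑ i ∈ s, cubeExp n (F i) w :=
  cubeMean_sum s fun i v => F i (cubeMerge n w v)

lemma cubeExp_nonneg {F : (Fin N → Bool) → ℝ} (h : ∀ w, 0 ≤ F w) (n : ℕ) (w : Fin N → Bool) :
    0 ≤ cubeExp n F w :=
  cubeMean_nonneg fun _ => h _

lemma norm_cubeExp_le (n : ℕ) (F : (Fin N → Bool) → V) (w : Fin N → Bool) :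
    ‖cubeExp n F w‖ ≤ cubeExp n (fun v => ‖F v‖) w :=
  norm_cubeMean_le _

/-- Restricting to a subcube commutes with the conditional expectations. -/
lemma cubeExp_comp_merge {n k : ℕ} (h : n ≤ k) (F : (Fin N → Bool) → V) (w v : Fin N → Bool) :
    cubeExp k (fun z => F (cubeMerge n w z)) v = cubeExp k F (cubeMerge n w v) := by
  simp only [cubeExp, cubeMerge_merge_of_ge h]

/-- The point of the cube with the `n`-th coordinate changed. -/
def cubeFlip (n : ℕ) (w : Fin N → Bool) : Fin N → Bool :=
  fun i => if (i : ℕ) = n then !(w i) else w i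

lemma cubeFlip_flip (n : ℕ) (w : Fin N → Bool) : cubeFlip n (cubeFlip n w) = w := by
  funext i
  simp only [cubeFlip]
  split_ifs <;> simp

lemma cubeMean_comp_flip (n : ℕ) (F : (Fin N → Bool) → V) :
    cubeMean (fun w => F (cubeFlip n w)) = cubeMean F := by
  simp only [cubeMean]
  congr 1
  exact Finset.sum_bij' (fun x _ => cubeFlip n x) (fun x _ => cubeFlip n x) (by simp) (by simp)
      (by simp [cubeFlip_flip]) (by simp [cubeFlip_flip]) (by simp)

lemma cubeExp_eq_half (n : ℕ) (F : (Fin N → Bool) → V) (w : Fin N → Bool) :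
    cubeExp n F w = (2⁻¹ : ℝ) • (cubeExp (n + 1) F w + cubeExp (n + 1) F (cubeFlip n w)) := by
  have hG := cubeExp_determined (n + 1) F
  rw [← cubeExp_cubeExp_of_le n.le_succ F w]
  set G := cubeExp (n + 1) F with hGdef
  -- Averaging over `v` is unchanged by flipping coordinate `n`. Of `v` and its flip, one agrees
  -- with `w` there and the other with the flip of `w`, so the sum of the two integrands is constant
  -- in `v`. If `n ≥ N`, the flip is the identity and the second case below applies.
  have h2 : cubeExp n G w + cubeExp n G w = G w + G (cubeFlip n w) := by
    have h1 : cubeExp n G w = cubeMean fun v => G (cubeMerge n w (cubeFlip n v)) :=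
      (cubeMean_comp_flip n fun v => G (cubeMerge n w v)).symm
    conv_lhs => arg 2; rw [h1]
    rw [cubeExp, ← cubeMean_add, ← cubeMean_const (N := N) (G w + G (cubeFlip n w))]
    congr 1
    funext v
    by_cases hv : ∃ i : Fin N, (i : ℕ) = n ∧ v i ≠ w i
    · obtain ⟨i, hi, hne⟩ := hv
      rw [add_comm]
      have e1 : cubeMerge (n + 1) w (cubeMerge n w (cubeFlip n v))
          = cubeMerge n w (cubeFlip n v) := by
        funext j
        simp only [cubeMerge, cubeFlip]
        split_ifs with h1 h2 h3 <;> try rfl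
        · have : j = i := Fin.ext (by omega)
          subst this
          cases hw : w j <;> cases hv : v j <;> simp_all
        · omega
      have e2 : cubeMerge (n + 1) (cubeFlip n w) (cubeMerge n w v) = cubeMerge n w v := by
        funext j
        simp only [cubeMerge, cubeFlip]
        split_ifs with h1 h2 h3 <;> try rfl
        all_goals try omega
        · have : j = i := Fin.ext (by omega)
          subst this
          cases hw : w j <;> cases hv : v j <;> simp_all
      rw [← hG w (cubeMerge n w (cubeFlip n v)), ← hG (cubeFlip n w) (cubeMerge n w v), e1, e2]
    · push Not at hv
      have e1 : cubeMerge (n + 1) w (cubeMerge n w v) = cubeMerge n w v := by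
        funext j
        simp only [cubeMerge]
        split_ifs with h1 h2 <;> try rfl
        exact (hv j (by omega)).symm
      have e2 : cubeMerge (n + 1) (cubeFlip n w) (cubeMerge n w (cubeFlip n v))
          = cubeMerge n w (cubeFlip n v) := by
        funext j
        simp only [cubeMerge, cubeFlip]
        split_ifs with h1 h2 h3 <;> try rfl
        all_goals try omega
        rw [hv j (by omega)]
      rw [← hG w (cubeMerge n w v), ← hG (cubeFlip n w) (cubeMerge n w (cubeFlip n v)), e1, e2]
  rw [← h2, ← two_smul ℝ, smul_smul]
  norm_num

/-- Dyadic regularity: the other half of the average is nonnegative. It controls the overshoot of a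
stopped martingale. -/
lemma cubeExp_succ_le_two_mul {F : (Fin N → Bool) → ℝ} (h : ∀ w, 0 ≤ F w) (n : ℕ)
    (w : Fin N → Bool) : cubeExp (n + 1) F w ≤ 2 * cubeExp n F w := by
  have h1 := cubeExp_eq_half n F w
  have h2 := cubeExp_nonneg h (n + 1) (cubeFlip n w)
  rw [smul_eq_mul] at h1
  linarith

end Cube

/-! ### Doob's maximal inequality -/

section Doob

variable {N : ℕ}

lemma rpow_young {r s x : ℝ} (hr : 1 < r) (hs : 0 ≤ s) (hx : 0 ≤ x) :
    r * (s ^ (r - 1) * x) ≤ (r - 1) * s ^ r + x ^ r := by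
  have hc := Real.HolderConjugate.conjExponent hr
  have h := Real.young_inequality_of_nonneg hx (Real.rpow_nonneg hs (r - 1)) hc
  rw [← Real.rpow_mul hs] at h
  have e : (r - 1) * Real.conjExponent r = r := by
    unfold Real.conjExponent
    field_simp [(by linarith : r - 1 ≠ 0)]
  rw [e] at h
  have e2 : s ^ r / Real.conjExponent r = (r - 1) / r * s ^ r := by
    unfold Real.conjExponent
    field_simp
  rw [e2] at h
  have hr0 : 0 < r := by linarith
  calc r * (s ^ (r - 1) * x) = r * (x * s ^ (r - 1)) := by ring
    _ ≤ r * (x ^ r / r + (r - 1) / r * s ^ r) := by gcongr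
    _ = _ := by field_simp; ring

/-- Pathwise form of Doob's inequality, with `s` the running maximum, `x` the current and `y` the
next value of the martingale. If the maximum does not move, equality holds; otherwise `s` is
replaced by `y` and the claim is Young's inequality. The last term on the right becomes a martingale
difference with predictable factor. -/
lemma doob_step {r s x y : ℝ} (hr : 1 < r) (hs : 0 ≤ s) (hy : 0 ≤ y) :
    (s ⊔ y) ^ r - r / (r - 1) * ((s ⊔ y) ^ (r - 1) * y)
      ≤ s ^ r - r / (r - 1) * (s ^ (r - 1) * x) - r / (r - 1) * (s ^ (r - 1) * (y - x)) := by
  rcases le_total y s with h | h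
  · rw [sup_eq_left.2 h]
    apply le_of_eq
    ring
  · rw [sup_eq_right.2 h]
    have e : y ^ (r - 1) * y = y ^ r := by
      rcases hy.eq_or_lt with rfl | hy
      · simp [Real.zero_rpow (by linarith : r ≠ 0)]
      · rw [← Real.rpow_add_one hy.ne']; simp
    rw [e]
    have hy := rpow_young hr hs hy
    have hr1 : 0 < r - 1 := by linarith
    have : (y ^ r - r / (r - 1) * y ^ r) - (s ^ r - r / (r - 1) * (s ^ (r - 1) * x)
        - r / (r - 1) * (s ^ (r - 1) * (y - x)))
        = (r * (s ^ (r - 1) * y) - ((r - 1) * s ^ r + y ^ r)) / (r - 1) := by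
      field_simp
      ring
    have h3 : (r * (s ^ (r - 1) * y) - ((r - 1) * s ^ r + y ^ r)) / (r - 1) ≤ 0 :=
      div_nonpos_of_nonpos_of_nonneg (by linarith) hr1.le
    linarith

lemma CubeDetermined.cubeMean_mul_sub {n : ℕ} {G : (Fin N → Bool) → ℝ} (hG : CubeDetermined n G)
    (F : (Fin N → Bool) → ℝ) :
    cubeMean (fun w => G w * (cubeExp (n + 1) F w - cubeExp n F w)) = 0 := by
  have h : ∀ w, cubeExp n (fun w => G w • (cubeExp (n + 1) F w - cubeExp n F w)) w = 0 := by
    intro w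
    rw [hG.cubeExp_smul, cubeExp_sub, cubeExp_cubeExp_of_le n.le_succ,
      cubeExp_cubeExp_of_le le_rfl]
    simp
  have h2 := cubeMean_cubeExp n (fun w => G w • (cubeExp (n + 1) F w - cubeExp n F w))
  rw [funext h, cubeMean_const] at h2
  exact h2.symm

/-- The maximal function of the martingale generated by `F`. -/
noncomputable def cubeSup (F : (Fin N → Bool) → ℝ) (n : ℕ) (w : Fin N → Bool) : ℝ :=
  partialSups (fun k => cubeExp k F w) n

lemma cubeSup_nonneg {F : (Fin N → Bool) → ℝ} (h : ∀ w, 0 ≤ F w) (n : ℕ) (w : Fin N → Bool) :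
    0 ≤ cubeSup F n w :=
  (cubeExp_nonneg h 0 w).trans (le_partialSups_of_le (fun k => cubeExp k F w) n.zero_le)

lemma cubeSup_determined (F : (Fin N → Bool) → ℝ) (n : ℕ) : CubeDetermined n (cubeSup F n) := by
  intro w v
  simp only [cubeSup, partialSups_eq_sup'_range]
  refine Finset.sup'_congr _ rfl fun k hk => ?_
  exact ((cubeExp_determined k F).mono (by simp at hk; omega)) w v

/-- By `doob_step` the integrand is a supermartingale: its increments are dominated by predictable
multiples of martingale differences, which have mean zero. -/
lemma doob_supermartingale {r : ℝ} (hr : 1 < r) {F : (Fin N → Bool) → ℝ} (h : ∀ w, 0 ≤ F w)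
    (n : ℕ) :
    cubeMean (fun w => cubeSup F n w ^ r
      - r / (r - 1) * (cubeSup F n w ^ (r - 1) * cubeExp n F w)) ≤ 0 := by
  induction n with
  | zero =>
    have := cubeMean_mono (F := fun w => cubeSup F 0 w ^ r
      - r / (r - 1) * (cubeSup F 0 w ^ (r - 1) * cubeExp 0 F w)) (G := fun _ => (0 : ℝ)) ?_
    · rwa [cubeMean_const] at this
    · intro w
      have h0 := cubeExp_nonneg h 0 w
      have := doob_step (x := 0) hr le_rfl h0
      rw [sup_eq_right.2 h0, Real.zero_rpow (by linarith : r ≠ 0),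
        Real.zero_rpow (by linarith : r - 1 ≠ 0)] at this
      simpa [cubeSup] using this
  | succ n ih =>
    have step := cubeMean_mono (F := fun w => cubeSup F (n + 1) w ^ r
      - r / (r - 1) * (cubeSup F (n + 1) w ^ (r - 1) * cubeExp (n + 1) F w))
      (G := fun w => (cubeSup F n w ^ r
        - r / (r - 1) * (cubeSup F n w ^ (r - 1) * cubeExp n F w))
        - (r / (r - 1) * cubeSup F n w ^ (r - 1)) * (cubeExp (n + 1) F w - cubeExp n F w)) ?_
    · refine step.trans ?_
      rw [cubeMean_sub, (((cubeSup_determined F n).comp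
        fun t => r / (r - 1) * t ^ (r - 1))).cubeMean_mul_sub F]
      simpa using ih
    · intro w
      have := doob_step (x := cubeExp n F w) hr (cubeSup_nonneg h n w)
        (cubeExp_nonneg h (n + 1) w)
      have e : cubeSup F (n + 1) w = cubeSup F n w ⊔ cubeExp (n + 1) F w := by
        simp only [cubeSup, partialSups_add_one]
      rw [e]
      refine this.trans (le_of_eq ?_)
      ring

/-- Doob's maximal inequality on the cube. -/
lemma doob_maximal {r : ℝ} (hr : 1 < r) {F : (Fin N → Bool) → ℝ} (h : ∀ w, 0 ≤ F w) :
    cubeMean (fun w => cubeSup F N w ^ r) ≤ 2 ^ r / (r - 1) * cubeMean fun w => F w ^ r := by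
  have hr1 : 0 < r - 1 := by linarith
  have h1 := doob_supermartingale hr h N
  rw [cubeMean_sub] at h1
  have h2 := cubeMean_mono (F := fun w => r / (r - 1) * (cubeSup F N w ^ (r - 1) * cubeExp N F w))
    (G := fun w => (2⁻¹ : ℝ) • cubeSup F N w ^ r + (2 ^ r / (2 * (r - 1))) • F w ^ r) ?_
  · rw [cubeMean_add, cubeMean_smul, cubeMean_smul] at h2
    simp only [smul_eq_mul] at h2
    have e : 2 ^ r / (r - 1) * cubeMean (fun w => F w ^ r)
      = 2 * (2 ^ r / (2 * (r - 1)) * cubeMean (fun w => F w ^ r)) := by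
      field_simp
    rw [e]
    linarith
  · intro w
    rw [cubeExp_of_ge le_rfl]
    -- Young is applied to `2 * F w` so that the power of the maximal function gets the factor `1/2`
    -- and can be absorbed.
    have hy := rpow_young hr (cubeSup_nonneg h N w) (mul_nonneg zero_le_two (h w))
    rw [Real.mul_rpow zero_le_two (h w)] at hy
    simp only [smul_eq_mul]
    calc r / (r - 1) * (cubeSup F N w ^ (r - 1) * F w)
        = (r * (cubeSup F N w ^ (r - 1) * (2 * F w))) / (2 * (r - 1)) := by field_simp
      _ ≤ ((r - 1) * cubeSup F N w ^ r + 2 ^ r * F w ^ r) / (2 * (r - 1)) := by gcongr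
      _ = _ := by field_simp

end Doob

/-! ### Martingale transforms and the good-`λ` inequality -/

section Transform

variable {N : ℕ} {E : Type*} [NormedAddCommGroup E] [NormedSpace ℂ E]

/-- The martingale transform of `F` with coefficients `a k`, stopped after `n` steps. -/
noncomputable def cubeTransform (a : ℕ → E) (n : ℕ) (F : (Fin N → Bool) → ℂ)
    (w : Fin N → Bool) : E :=
  ∑ k ∈ Finset.range n, (cubeExp (k + 1) F w - cubeExp k F w) • a k

/-- The uniform probability of a subset of the cube. -/
noncomputable def cubeProb (B : Set (Fin N → Bool)) : ℝ :=
  cubeMean (B.indicator fun _ => (1 : ℝ))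

lemma cubeProb_mono {A B : Set (Fin N → Bool)} (h : A ⊆ B) : cubeProb A ≤ cubeProb B :=
  cubeMean_mono fun w => Set.indicator_le_indicator_of_subset h (fun _ => zero_le_one) w

lemma cubeProb_nonneg (A : Set (Fin N → Bool)) : 0 ≤ cubeProb A :=
  cubeMean_nonneg fun w => Set.indicator_nonneg (fun _ _ => zero_le_one) w

lemma cubeProb_univ : cubeProb (Set.univ : Set (Fin N → Bool)) = 1 := by
  simp [cubeProb, cubeMean_const]

lemma cubeProb_union_le (A B : Set (Fin N → Bool)) :
    cubeProb (A ∪ B) ≤ cubeProb A + cubeProb B := by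
  rw [cubeProb, cubeProb, cubeProb, ← cubeMean_add]
  refine cubeMean_mono fun w => ?_
  by_cases hA : w ∈ A <;> by_cases hB : w ∈ B <;> simp [hA, hB]

lemma cubeTransform_determined (a : ℕ → E) (n : ℕ) (F : (Fin N → Bool) → ℂ) :
    CubeDetermined n (cubeTransform a n F) := by
  intro w v
  refine Finset.sum_congr rfl fun k hk => ?_
  have hk : k + 1 ≤ n := Finset.mem_range.1 hk
  rw [((cubeExp_determined (k + 1) F).mono hk) w v,
    ((cubeExp_determined k F).mono (by omega : k ≤ n)) w v]

/-- The transform with respect to `a` is, with probability at least `1 - δ`, bounded by `K` on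
functions bounded by one. -/
def CubeTailBound (N : ℕ) (a : ℕ → E) (K δ : ℝ) : Prop :=
  ∀ F : (Fin N → Bool) → ℂ, (∀ w, ‖F w‖ ≤ 1) → cubeProb {w | K < ‖cubeTransform a N F w‖} ≤ δ

lemma CubeTailBound.scaled {a : ℕ → E} {K δ : ℝ} (h : CubeTailBound N a K δ)
    {F : (Fin N → Bool) → ℂ} {c : ℝ} (hc : 0 < c) (hF : ∀ w, ‖F w‖ ≤ c) :
    cubeProb {w | c * K < ‖cubeTransform a N F w‖} ≤ δ := by
  have h1 := h (fun w => (c : ℂ)⁻¹ • F w) fun w => by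
    rw [norm_smul, norm_inv, Complex.norm_real, Real.norm_of_nonneg hc.le]
    exact inv_mul_le_one_of_le₀ (hF w) hc.le
  refine (cubeProb_mono fun w hw => ?_).trans h1
  have e : cubeTransform a N (fun w => (c : ℂ)⁻¹ • F w) w
      = (c : ℂ)⁻¹ • cubeTransform a N F w := by
    simp only [cubeTransform, Finset.smul_sum, cubeExp, cubeMean_smul, ← smul_sub, smul_assoc]
  simp only [Set.mem_ofPred_eq] at hw ⊢
  rw [e, norm_smul, norm_inv, Complex.norm_real, Real.norm_of_nonneg hc.le,
    lt_inv_mul_iff₀ hc]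
  exact hw

lemma cubeExp_eq_zero_of_le {V : Type*} [NormedAddCommGroup V] [NormedSpace ℝ V]
    {F : (Fin N → Bool) → V} {k n : ℕ} (hk : k ≤ n) (h : ∀ w, cubeExp n F w = 0)
    (w : Fin N → Bool) : cubeExp k F w = 0 := by
  rw [← cubeExp_cubeExp_of_le hk, funext h]
  exact cubeMean_const 0

/-- The tail bound on subcubes. -/
lemma CubeTailBound.local {a : ℕ → E} {K δ : ℝ} (h : CubeTailBound N a K δ)
    {F : (Fin N → Bool) → ℂ} {c : ℝ} (hc : 0 < c) (hF : ∀ w, ‖F w‖ ≤ c) {n : ℕ}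
    (hn : ∀ w, cubeExp n F w = 0) (w : Fin N → Bool) :
    cubeProb {v | c * K < ‖cubeTransform a N F (cubeMerge n w v)‖} ≤ δ := by
  have h1 := h.scaled (F := fun v => F (cubeMerge n w v)) hc fun v => hF _
  -- From level `n` on, restriction to the subcube commutes with conditioning; below it both sides
  -- vanish by `hn`. So the transform of the restriction is the restriction of the transform.
  have e : ∀ k v, cubeExp k (fun v => F (cubeMerge n w v)) v = cubeExp k F (cubeMerge n w v) := by
    intro k v
    rcases le_total n k with hk | hk
    · exact cubeExp_comp_merge hk F w v
    · rw [cubeExp_eq_zero_of_le hk hn]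
      exact cubeExp_eq_zero_of_le hk (fun v => by rw [cubeExp_comp_merge le_rfl, hn]) v
  simpa only [cubeTransform, e] using h1

/-- Terms with `k < j` are determined by the first `j` coordinates; the others are predictable
multiples of differences that average to zero. -/
lemma cubeExp_martingale_sum (F : (Fin N → Bool) → ℂ) (g : ℕ → (Fin N → Bool) → ℂ)
    (hg : ∀ k, CubeDetermined k (g k)) (L j : ℕ) (w : Fin N → Bool) :
    cubeExp j (fun w => ∑ k ∈ Finset.range L, g k w • (cubeExp (k + 1) F w - cubeExp k F w)) w
      = ∑ k ∈ Finset.range L,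
        if k < j then g k w • (cubeExp (k + 1) F w - cubeExp k F w) else 0 := by
  rw [cubeExp_sum]
  refine Finset.sum_congr rfl fun k _ => ?_
  split_ifs with hk
  · refine CubeDetermined.cubeExp_eq (fun w v => ?_) w
    rw [((hg k).mono hk.le) w v, ((cubeExp_determined (k + 1) F).mono hk) w v,
      ((cubeExp_determined k F).mono hk.le) w v]
  · push Not at hk
    refine cubeExp_eq_zero_of_le hk (fun w => ?_) w
    rw [(hg k).cubeExp_smul, cubeExp_sub, cubeExp_cubeExp_of_le k.le_succ,
      cubeExp_cubeExp_of_le le_rfl, sub_self, smul_zero]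

lemma cubeTransform_martingale_sum (a : ℕ → E) (F : (Fin N → Bool) → ℂ)
    (g : ℕ → (Fin N → Bool) → ℂ) (hg : ∀ k, CubeDetermined k (g k)) (w : Fin N → Bool) :
    cubeTransform a N
      (fun w => ∑ k ∈ Finset.range N, g k w • (cubeExp (k + 1) F w - cubeExp k F w)) w
      = ∑ k ∈ Finset.range N, g k w • (cubeExp (k + 1) F w - cubeExp k F w) • a k := by
  refine Finset.sum_congr rfl fun j hj => ?_
  rw [cubeExp_martingale_sum F g hg, cubeExp_martingale_sum F g hg, ← Finset.sum_sub_distrib,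
    Finset.sum_eq_single j]
  · simp [smul_smul]
  · intro k _ hk
    by_cases h1 : k < j
    · simp [h1, h1.trans j.lt_succ_self]
    · have : ¬ k < j + 1 := by omega
      simp [h1, this]
  · exact fun h => absurd hj h

/-- The coefficients are bounded: apply the tail bound to a Rademacher function. -/
lemma CubeTailBound.norm_le {a : ℕ → E} {K δ : ℝ} (h : CubeTailBound N a K δ) (hδ : δ < 1)
    {k : ℕ} (hk : k < N) : ‖a k‖ ≤ K := by
  by_contra! hlt
  set R : (Fin N → Bool) → ℂ := fun w => if w ⟨k, hk⟩ then 1 else -1 with hR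
  have hRn : ∀ w, ‖R w‖ = 1 := fun w => by simp only [hR]; split_ifs <;> simp
  have hdet : CubeDetermined (k + 1) R := fun w v => by simp [hR, cubeMerge]
  have hflip : ∀ w, R (cubeFlip k w) = -R w := fun w => by
    simp only [hR, cubeFlip]
    cases w ⟨k, hk⟩ <;> simp
  have h0 : ∀ w, cubeExp k R w = 0 := fun w => by
    rw [cubeExp_eq_half, hdet.cubeExp_eq, hdet.cubeExp_eq, hflip, add_neg_cancel, smul_zero]
  have hlow : ∀ j ≤ k, ∀ w, cubeExp j R w = 0 := fun j hj => cubeExp_eq_zero_of_le hj h0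
  have hT : ∀ w, cubeTransform a N R w = R w • a k := fun w => by
    rw [cubeTransform, Finset.sum_eq_single k]
    · rw [hdet.cubeExp_eq, h0, sub_zero]
    · intro j _ hj
      rcases lt_or_gt_of_ne hj with h1 | h1
      · rw [hlow (j + 1) h1, hlow j h1.le, sub_zero, zero_smul]
      · rw [(hdet.mono (by omega : k + 1 ≤ j + 1)).cubeExp_eq, (hdet.mono h1).cubeExp_eq,
          sub_self, zero_smul]
    · simp [hk]
  have := h R fun w => (hRn w).le
  have hU : {w | K < ‖cubeTransform a N R w‖} = Set.univ := by
    ext w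
    simp [hT, norm_smul, hRn, hlt]
  rw [hU, cubeProb_univ] at this
  linarith

/-- A condition inherited by earlier times holds on an initial segment, so the times from `n` on at
which it holds form an interval: `s` is the value of a stopping time, kept between `n` and `N`. -/
lemma exists_stopping_index {p : ℕ → Prop} (hp : ∀ i j, i ≤ j → p j → p i) {n N : ℕ}
    (hn : n ≤ N) : ∃ s, n ≤ s ∧ s ≤ N ∧ ∀ k < N, (n ≤ k ∧ p k) ↔ (n ≤ k ∧ k < s) := by
  classical
  induction N, hn using Nat.le_induction with
  | base => exact ⟨n, le_rfl, le_rfl, fun k hk => ⟨fun h => by omega, fun h => by omega⟩⟩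
  | succ N hN ih =>
    obtain ⟨s, h1, h2, h3⟩ := ih
    by_cases hpN : p N
    · exact ⟨N + 1, by omega, le_rfl, fun k hk =>
        ⟨fun h => ⟨h.1, hk⟩, fun h => ⟨h.1, hp k N (by omega) hpN⟩⟩⟩
    · refine ⟨s, h1, by omega, fun k hk => ?_⟩
      rcases (by omega : k < N ∨ k = N) with h | rfl
      · exact h3 k h
      · exact ⟨fun h => absurd h.2 hpN, fun h => by omega⟩

lemma sum_ite_smul {V : Type*} [AddCommGroup V] [Module ℂ V] {c : ℕ → ℂ} {n s N : ℕ} (hs : s ≤ N)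
    (hc : ∀ k < N, c k = if n ≤ k ∧ k < s then 1 else 0) (x : ℕ → V) :
    ∑ k ∈ Finset.range N, c k • x k = ∑ k ∈ Finset.Ico n s, x k := by
  have h : ∀ k ∈ Finset.range N, c k • x k = if n ≤ k ∧ k < s then x k else 0 := fun k hk => by
    rw [hc k (Finset.mem_range.1 hk)]
    split_ifs <;> simp
  rw [Finset.sum_congr rfl h, ← Finset.sum_filter]
  congr 1
  ext k
  simp only [Finset.mem_filter, Finset.mem_range, Finset.mem_Ico]
  omega

/-- The maximal function of the martingale transform. -/
noncomputable def transformSup (a : ℕ → E) (F : (Fin N → Bool) → ℂ) (w : Fin N → Bool) : ℝ :=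
  partialSups (fun k => ‖cubeTransform a k F w‖) N

lemma cubeTransform_sub (a : ℕ → E) (F : (Fin N → Bool) → ℂ) {n s : ℕ} (h : n ≤ s)
    (w : Fin N → Bool) :
    ∑ k ∈ Finset.Ico n s, (cubeExp (k + 1) F w - cubeExp k F w) • a k
      = cubeTransform a s F w - cubeTransform a n F w :=
  Finset.sum_Ico_eq_sub _ h

/-- Let `f` be the increment of `F` from time `n` until the transform exceeds `12 * K * μ` or the
conditional mean of `‖F‖` exceeds `μ`. Then `f` is bounded by `3 * μ` and has zero conditional
expectation at level `n`, so the tail bound on the subcube applies. On the event in question the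
transform of `f` exceeds `3 * K * μ`. -/
lemma good_lambda_local {a : ℕ → E} {K δ : ℝ} (hK : 0 < K) (hδ : δ < 1)
    (h : CubeTailBound N a K δ) (F : (Fin N → Bool) → ℂ) {μ : ℝ} (hμ : 0 < μ) {n : ℕ}
    (hnN : n ≤ N) (w₀ : Fin N → Bool) :
    cubeProb {v | (12 * K * μ < transformSup a F (cubeMerge n w₀ v) ∧
      cubeSup (fun w => ‖F w‖) N (cubeMerge n w₀ v) ≤ μ) ∧
      ∀ j < n, ‖cubeTransform a j F (cubeMerge n w₀ v)‖ ≤ 6 * K * μ} ≤ δ := by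
  classical
  have hF0 : ∀ w, 0 ≤ ‖F w‖ := fun w => norm_nonneg _
  set p : (Fin N → Bool) → ℕ → Prop := fun w k =>
    (∀ j ≤ k, ‖cubeTransform a j F w‖ ≤ 12 * K * μ) ∧
      ∀ j ≤ k, cubeExp j (fun w => ‖F w‖) w ≤ μ with hp
  have hpanti : ∀ w i j, i ≤ j → p w j → p w i := fun w i j hij hj =>
    ⟨fun l hl => hj.1 l (hl.trans hij), fun l hl => hj.2 l (hl.trans hij)⟩
  have hpdet : ∀ k, CubeDetermined k fun w => p w k := by
    intro k w v
    simp only [hp, eq_iff_iff]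
    refine and_congr (forall₂_congr fun j hj => ?_) (forall₂_congr fun j hj => ?_)
    · rw [((cubeTransform_determined a j F).mono hj) w v]
    · rw [((cubeExp_determined j _).mono hj) w v]
  set g : ℕ → (Fin N → Bool) → ℂ := fun k w => if n ≤ k ∧ p w k then 1 else 0 with hg
  have hgdet : ∀ k, CubeDetermined k (g k) := fun k w v => by
    have h1 : p (cubeMerge k w v) k = p w k := hpdet k w v
    simp only [hg, h1]
  set f : (Fin N → Bool) → ℂ := fun w =>
    ∑ k ∈ Finset.range N, g k w • (cubeExp (k + 1) F w - cubeExp k F w) with hf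
  -- sums against `g` telescope up to a stopping index
  have hex : ∀ w, ∃ s, n ≤ s ∧ s ≤ N ∧ (∀ k < N, (n ≤ k ∧ p w k) ↔ (n ≤ k ∧ k < s)) := fun w =>
    exists_stopping_index (hpanti w) hnN
  have hgs : ∀ w s, (∀ k < N, (n ≤ k ∧ p w k) ↔ (n ≤ k ∧ k < s)) →
      ∀ k < N, g k w = if n ≤ k ∧ k < s then 1 else 0 := fun w s hiff k hk => by
    simp only [hg, hiff k hk]
  have hfbound : ∀ w, ‖f w‖ ≤ 3 * μ := by
    intro w
    obtain ⟨s, hns, hsN, hiff⟩ := hex w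
    have e : f w = cubeExp s F w - cubeExp n F w := by
      rw [hf]
      simp only
      rw [sum_ite_smul hsN (hgs w s hiff), Finset.sum_Ico_eq_sub _ hns,
        Finset.sum_range_sub fun k => cubeExp k F w, Finset.sum_range_sub fun k => cubeExp k F w]
      ring
    rw [e]
    rcases hns.eq_or_lt with rfl | hlt
    · rw [sub_self, norm_zero]; positivity
    · have hps : p w (s - 1) := ((hiff (s - 1) (by omega)).2 ⟨by omega, by omega⟩).2
      have h1 : cubeExp n (fun w => ‖F w‖) w ≤ μ := hps.2 n (by omega)
      -- The stopping conditions hold at `s - 1`, so at `s` the conditional mean has at most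
      -- doubled.
      have h2 : cubeExp s (fun w => ‖F w‖) w ≤ 2 * μ := by
        have := cubeExp_succ_le_two_mul hF0 (s - 1) w
        rw [Nat.sub_add_cancel (by omega)] at this
        linarith [hps.2 (s - 1) le_rfl]
      calc ‖cubeExp s F w - cubeExp n F w‖ ≤ ‖cubeExp s F w‖ + ‖cubeExp n F w‖ := norm_sub_le _ _
        _ ≤ 2 * μ + μ := add_le_add ((norm_cubeExp_le s F w).trans h2)
            ((norm_cubeExp_le n F w).trans h1)
        _ = 3 * μ := by ring
  have hfn : ∀ w, cubeExp n f w = 0 := by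
    intro w
    rw [hf, cubeExp_martingale_sum F g hgdet]
    refine Finset.sum_eq_zero fun k _ => ?_
    split_ifs with hk
    · simp [hg, hk.not_ge]
    · rfl
  refine (cubeProb_mono fun v hv => ?_).trans (h.local (by positivity) hfbound hfn w₀)
  obtain ⟨⟨hv1, hv2⟩, hv3⟩ := hv
  simp only [Set.mem_ofPred_eq]
  generalize cubeMerge n w₀ v = w at hv1 hv2 hv3 ⊢
  have hF : ∀ j ≤ N, cubeExp j (fun w => ‖F w‖) w ≤ μ := fun j hj =>
    (le_partialSups_of_le (fun k => cubeExp k (fun w => ‖F w‖) w) hj).trans hv2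
  obtain ⟨m, hmN, hm⟩ : ∃ m ≤ N, 12 * K * μ < ‖cubeTransform a m F w‖ := by
    by_contra! hcon
    exact absurd hv1 (not_lt.2 (partialSups_le _ _ _ hcon))
  -- Before time `n` the transform is at most `6 * K * μ`; the last jump adds at most `2 * μ` times
  -- the norm of one coefficient, which is at most `K`.
  have hgn : ‖cubeTransform a n F w‖ ≤ 8 * K * μ := by
    rcases Nat.eq_zero_or_pos n with rfl | hn
    · simp only [cubeTransform, Finset.range_zero, Finset.sum_empty, norm_zero]
      positivity
    · obtain ⟨n, rfl⟩ : ∃ n', n = n' + 1 := ⟨n - 1, by omega⟩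
      have e : cubeTransform a (n + 1) F w
          = cubeTransform a n F w + (cubeExp (n + 1) F w - cubeExp n F w) • a n :=
        Finset.sum_range_succ _ _
      have h1 : ‖cubeExp (n + 1) F w - cubeExp n F w‖ ≤ μ + μ :=
        (norm_sub_le _ _).trans (add_le_add ((norm_cubeExp_le _ F w).trans (hF _ hnN))
          ((norm_cubeExp_le _ F w).trans (hF _ (by omega))))
      have h2 := h.norm_le hδ (k := n) (by omega)
      calc _ ≤ ‖cubeTransform a n F w‖ + ‖(cubeExp (n + 1) F w - cubeExp n F w) • a n‖ := by
            rw [e]; exact norm_add_le _ _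
        _ ≤ 6 * K * μ + (μ + μ) * K := by
            rw [norm_smul]
            gcongr
            exact hv3 n (by omega)
        _ = 8 * K * μ := by ring
  obtain ⟨s, hns, hsN, hiff⟩ := hex w
  -- Here the maximal function of `‖F‖` stays below `μ`, so only the size of the transform can cause
  -- stopping; it does exceed the level at `m`, hence also at `s`.
  have hs : 12 * K * μ < ‖cubeTransform a s F w‖ := by
    by_contra! hcon
    have hall : ∀ j ≤ s, ‖cubeTransform a j F w‖ ≤ 12 * K * μ := by
      intro j hj
      rcases hj.eq_or_lt with rfl | hj
      · exact hcon
      rcases lt_or_ge j n with h1 | h1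
      · exact (hv3 j h1).trans (by gcongr; norm_num)
      · exact ((hiff j (by omega)).2 ⟨h1, hj⟩).2.1 j le_rfl
    rcases hsN.eq_or_lt with rfl | hlt
    · exact absurd (hall m hmN) (not_le.2 hm)
    · have := (hiff s hlt).1 ⟨hns, hall, fun j hj => hF j (hj.trans hsN)⟩
      omega
  have e : cubeTransform a N f w = cubeTransform a s F w - cubeTransform a n F w := by
    rw [hf, cubeTransform_martingale_sum a F g hgdet, 
      sum_ite_smul hsN (hgs w s hiff), cubeTransform_sub a F hns]
  rw [e]
  -- The transform of `f` is larger than `(12 - 8) * K * μ`, which beats `3 * μ * K`.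
  have h3 := norm_sub_norm_le (cubeTransform a s F w) (cubeTransform a n F w)
  have h4 : 0 < K * μ := by positivity
  nlinarith

/-- The good-`λ` inequality for the martingale transform and the maximal function. -/
lemma good_lambda {a : ℕ → E} {K δ : ℝ} (hK : 0 < K) (hδ : δ < 1)
    (h : CubeTailBound N a K δ) (F : (Fin N → Bool) → ℂ) {μ : ℝ} (hμ : 0 < μ) :
    cubeProb {w | 12 * K * μ < transformSup a F w}
      ≤ δ * cubeProb {w | 6 * K * μ < transformSup a F w}
        + cubeProb {w | μ < cubeSup (fun w => ‖F w‖) N w} := by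
  classical
  set B := {w | 12 * K * μ < transformSup a F w ∧ cubeSup (fun w => ‖F w‖) N w ≤ μ} with hB
  -- The event that `n` is the first time the transform exceeds `6 * K * μ`. These events are
  -- disjoint, are determined by the first `n` coordinates, and cover `B`.
  set A : ℕ → Set (Fin N → Bool) := fun n => {w | 6 * K * μ < ‖cubeTransform a n F w‖ ∧
    ∀ j < n, ‖cubeTransform a j F w‖ ≤ 6 * K * μ} with hA
  have hAdet : ∀ n, CubeDetermined n fun w => w ∈ A n := by
    intro n w v
    simp only [hA, eq_iff_iff, Set.mem_ofPred_eq]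
    rw [cubeTransform_determined a n F w v]
    refine and_congr Iff.rfl (forall₂_congr fun j hj => ?_)
    rw [((cubeTransform_determined a j F).mono hj.le) w v]
  have hBA : cubeProb B ≤ ∑ n ∈ Finset.range (N + 1), cubeProb (B ∩ A n) := by
    simp only [cubeProb]
    rw [← cubeMean_sum]
    refine cubeMean_mono fun w => ?_
    by_cases hw : w ∈ B
    · have hex : ∃ m, m ≤ N ∧ 6 * K * μ < ‖cubeTransform a m F w‖ := by
        by_contra! hcon
        have h1 : transformSup a F w ≤ 6 * K * μ := partialSups_le _ _ _ hcon
        have h2 := hw.1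
        have h4 : 0 < K * μ := by positivity
        nlinarith
      have hmem : w ∈ B ∩ A (Nat.find hex) := ⟨hw, (Nat.find_spec hex).2, fun j hj => by
        have := Nat.find_min hex hj
        push Not at this
        exact this (hj.le.trans (Nat.find_spec hex).1)⟩
      calc B.indicator (fun _ => (1 : ℝ)) w
          = (B ∩ A (Nat.find hex)).indicator (fun _ => (1 : ℝ)) w := by
            rw [Set.indicator_of_mem hw, Set.indicator_of_mem hmem]
        _ ≤ _ := Finset.single_le_sum
            (f := fun n => (B ∩ A n).indicator (fun _ => (1 : ℝ)) w)
            (fun n _ => Set.indicator_nonneg (fun _ _ => zero_le_one) w)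
            (Finset.mem_range.2 (Nat.lt_succ_of_le (Nat.find_spec hex).1))
    · rw [Set.indicator_of_notMem hw]
      exact Finset.sum_nonneg fun n _ => Set.indicator_nonneg (fun _ _ => zero_le_one) w
  have hloc : ∀ n ∈ Finset.range (N + 1), cubeProb (B ∩ A n) ≤ δ * cubeProb (A n) := by
    intro n hn
    have hn : n ≤ N := Nat.lt_succ_iff.1 (Finset.mem_range.1 hn)
    -- Condition on the first `n` coordinates and use the local estimate on each subcube inside `A
    -- n`.
    rw [cubeProb, ← cubeMean_cubeExp n, cubeProb, ← smul_eq_mul, ← cubeMean_smul]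
    refine cubeMean_mono fun w => ?_
    by_cases hw : w ∈ A n
    · rw [Set.indicator_of_mem hw, smul_eq_mul, mul_one]
      refine le_trans ?_ (good_lambda_local hK hδ h F hμ hn w)
      refine cubeMean_mono fun v => ?_
      rw [Set.indicator_apply, Set.indicator_apply]
      split_ifs with h1 h2
      · exact le_rfl
      · exact absurd ⟨h1.1, h1.2.2⟩ h2
      · exact zero_le_one
      · exact le_rfl
    · rw [Set.indicator_of_notMem hw, smul_zero, cubeExp]
      have : ∀ v, (B ∩ A n).indicator (fun _ => (1 : ℝ)) (cubeMerge n w v) = 0 := fun v =>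
        Set.indicator_of_notMem (fun hv => hw ((hAdet n w v).mp hv.2)) _
      simp only [this, cubeMean_const, le_refl]
  have hδ0 : 0 ≤ δ := (cubeProb_nonneg _).trans (h (fun _ => 0) (by simp))
  have hAsum : ∑ n ∈ Finset.range (N + 1), cubeProb (A n)
      ≤ cubeProb {w | 6 * K * μ < transformSup a F w} := by
    simp only [cubeProb]
    rw [← cubeMean_sum]
    refine cubeMean_mono fun w => ?_
    by_cases hex : ∃ n ∈ Finset.range (N + 1), w ∈ A n
    · obtain ⟨n, hn, hwn⟩ := hex
      rw [Finset.sum_eq_single_of_mem n hn, Set.indicator_of_mem hwn, Set.indicator_of_mem]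
      · exact hwn.1.trans_le (le_partialSups_of_le (fun k => ‖cubeTransform a k F w‖)
          (Nat.lt_succ_iff.1 (Finset.mem_range.1 hn)))
      · intro m _ hmn
        refine Set.indicator_of_notMem (fun hm => ?_) _
        rcases lt_or_gt_of_ne hmn with h1 | h1
        · exact absurd hm.1 (not_lt.2 (hwn.2 m h1))
        · exact absurd hwn.1 (not_lt.2 (hm.2 n h1))
    · push Not at hex
      rw [Finset.sum_eq_zero fun n hn => Set.indicator_of_notMem (hex n hn) _]
      exact Set.indicator_nonneg (fun _ _ => zero_le_one) w
  calc cubeProb {w | 12 * K * μ < transformSup a F w}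
      ≤ cubeProb (B ∪ {w | μ < cubeSup (fun w => ‖F w‖) N w}) := by
        refine cubeProb_mono fun w hw => ?_
        rcases le_or_gt (cubeSup (fun w => ‖F w‖) N w) μ with h1 | h1
        · exact Or.inl ⟨hw, h1⟩
        · exact Or.inr h1
    _ ≤ cubeProb B + cubeProb {w | μ < cubeSup (fun w => ‖F w‖) N w} := cubeProb_union_le _ _
    _ ≤ _ := by
        gcongr
        calc _ ≤ _ := hBA
          _ ≤ _ := Finset.sum_le_sum hloc
          _ ≤ _ := by rw [← Finset.mul_sum]; gcongr

end Transform

/-! ### Uniform measure, integration of tails, extrapolation -/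

section CubeMeasure

variable {N : ℕ}

/-- The uniform probability measure on the cube. -/
noncomputable def cubeMeasure (N : ℕ) : Measure (Fin N → Bool) :=
  ENNReal.ofReal ((2 ^ N)⁻¹) • Measure.count

lemma lintegral_cubeMeasure {φ : (Fin N → Bool) → ℝ} (h : ∀ w, 0 ≤ φ w) :
    ∫⁻ w, ENNReal.ofReal (φ w) ∂cubeMeasure N = ENNReal.ofReal (cubeMean φ) := by
  rw [cubeMeasure, lintegral_smul_measure, lintegral_count, tsum_fintype,
    ← ENNReal.ofReal_sum_of_nonneg fun w _ => h w, smul_eq_mul,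
    ← ENNReal.ofReal_mul (by positivity)]
  rfl

lemma cubeMeasure_apply (B : Set (Fin N → Bool)) :
    cubeMeasure N B = ENNReal.ofReal (cubeProb B) := by
  rw [cubeProb, ← lintegral_cubeMeasure fun w => Set.indicator_nonneg (fun _ _ => zero_le_one) w,
    ← lintegral_indicator_one (MeasurableSet.of_discrete)]
  congr 1
  funext w
  by_cases hw : w ∈ B <;> simp [hw]

instance : IsProbabilityMeasure (cubeMeasure N) :=
  ⟨by rw [cubeMeasure_apply, cubeProb_univ, ENNReal.ofReal_one]⟩

/-- Integration of a distributional inequality. -/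
lemma cubeMean_rpow_le_of_cubeProb_le {G₁ G₂ G₃ : (Fin N → Bool) → ℝ} (h₁ : ∀ w, 0 ≤ G₁ w)
    (h₂ : ∀ w, 0 ≤ G₂ w) (h₃ : ∀ w, 0 ≤ G₃ w) {δ r : ℝ} (hδ : 0 ≤ δ) (hr : 0 < r)
    (h : ∀ t : ℝ, 0 < t →
      cubeProb {w | t < G₁ w} ≤ δ * cubeProb {w | t < G₂ w} + cubeProb {w | t < G₃ w}) :
    cubeMean (fun w => G₁ w ^ r) ≤ δ * cubeMean (fun w => G₂ w ^ r)
      + cubeMean fun w => G₃ w ^ r := by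
  have nn : ∀ {G : (Fin N → Bool) → ℝ}, (∀ w, 0 ≤ G w) → ∀ w, 0 ≤ G w ^ r :=
    fun hG w => Real.rpow_nonneg (hG w) r
  -- The layer cake formula.
  have lc : ∀ G : (Fin N → Bool) → ℝ, (∀ w, 0 ≤ G w) → ENNReal.ofReal (cubeMean fun w => G w ^ r)
      = ENNReal.ofReal r * ∫⁻ t in Set.Ioi 0, cubeMeasure N {w | t < G w}
        * ENNReal.ofReal (t ^ (r - 1)) := fun G hG => by
    rw [← lintegral_cubeMeasure (nn hG)]
    exact lintegral_rpow_eq_lintegral_meas_lt_mul _ (Filter.Eventually.of_forall hG)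
      (Measurable.of_discrete).aemeasurable hr
  have meas : ∀ G : (Fin N → Bool) → ℝ, Measurable fun t : ℝ => cubeMeasure N {w | t < G w}
        * ENNReal.ofReal (t ^ (r - 1)) := fun G => by
    refine Measurable.mul ?_ (by fun_prop)
    refine Antitone.measurable fun s t hst => measure_mono fun w hw => lt_of_le_of_lt hst hw
  rw [← ENNReal.ofReal_le_ofReal_iff (add_nonneg (mul_nonneg hδ (cubeMean_nonneg (nn h₂)))
    (cubeMean_nonneg (nn h₃))), ENNReal.ofReal_add (mul_nonneg hδ (cubeMean_nonneg (nn h₂)))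
    (cubeMean_nonneg (nn h₃)), ENNReal.ofReal_mul hδ, lc _ h₁, lc _ h₂, lc _ h₃, mul_left_comm,
    ← mul_add, ← lintegral_const_mul _ (meas G₂), ← lintegral_add_left ((meas G₂).const_mul _)]
  gcongr ENNReal.ofReal r * ?_
  refine setLIntegral_mono' measurableSet_Ioi fun t ht => ?_
  rw [← mul_assoc, ← add_mul]
  gcongr
  rw [cubeMeasure_apply, cubeMeasure_apply, cubeMeasure_apply, ← ENNReal.ofReal_mul hδ,
    ← ENNReal.ofReal_add (mul_nonneg hδ (cubeProb_nonneg _)) (cubeProb_nonneg _)]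
  exact ENNReal.ofReal_le_ofReal (h t ht)

lemma eLpNorm_cubeMeasure {V : Type*} [NormedAddCommGroup V] (F : (Fin N → Bool) → V) {p : ℝ}
    (hp : 0 < p) : eLpNorm F (ENNReal.ofReal p) (cubeMeasure N)
      = ENNReal.ofReal ((cubeMean fun w => ‖F w‖ ^ p) ^ (1 / p)) := by
  have h0 : ∀ w, 0 ≤ ‖F w‖ ^ p := fun w => by positivity
  rw [eLpNorm_eq_lintegral_rpow_enorm_toReal (by simpa using hp) ENNReal.ofReal_ne_top,
    ENNReal.toReal_ofReal hp.le,
    ← ENNReal.ofReal_rpow_of_nonneg (cubeMean_nonneg h0) (by positivity),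
    ← lintegral_cubeMeasure h0]
  congr 2
  funext w
  rw [← ENNReal.ofReal_rpow_of_nonneg (norm_nonneg _) hp.le, ofReal_norm]

variable {E : Type*} [NormedAddCommGroup E] [NormedSpace ℂ E]

/-- A tail bound on bounded functions implies the strong type inequality. -/
lemma CubeTailBound.cubeMean_rpow_le {a : ℕ → E} {K r : ℝ} (hK : 0 < K) (hr : 1 < r)
    (h : CubeTailBound N a K ((2 ^ r)⁻¹ / 2)) (F : (Fin N → Bool) → ℂ) :
    cubeMean (fun w => ‖cubeTransform a N F w‖ ^ r)
      ≤ 2 * 24 ^ r / (r - 1) * K ^ r * cubeMean fun w => ‖F w‖ ^ r := by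
  have hr0 : 0 < r := by linarith
  have hδ : (2 ^ r : ℝ)⁻¹ / 2 < 1 := by
    have : (2 ^ r : ℝ)⁻¹ ≤ 1 := inv_le_one_of_one_le₀ (Real.one_le_rpow one_le_two hr0.le)
    linarith
  have hF0 : ∀ w, 0 ≤ ‖F w‖ := fun w => norm_nonneg _
  have hS0 : ∀ w, 0 ≤ transformSup a F w := fun w =>
    (norm_nonneg _).trans (le_partialSups_of_le (fun k => ‖cubeTransform a k F w‖) N.zero_le)
  have h1 := cubeMean_rpow_le_of_cubeProb_le (r := r) (δ := (2 ^ r : ℝ)⁻¹ / 2)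
    (G₁ := fun w => (12 * K)⁻¹ * transformSup a F w)
    (G₂ := fun w => (6 * K)⁻¹ * transformSup a F w) (G₃ := cubeSup (fun w => ‖F w‖) N)
    (fun w => mul_nonneg (by positivity) (hS0 w)) (fun w => mul_nonneg (by positivity) (hS0 w))
    (cubeSup_nonneg hF0 N) (by positivity) hr0 fun t ht => by
      simp only [lt_inv_mul_iff₀ (by positivity : 0 < 12 * K),
        lt_inv_mul_iff₀ (by positivity : 0 < 6 * K)]
      exact good_lambda hK hδ h F ht
  have hpow : ∀ c : ℝ, 0 < c → cubeMean (fun w => (c⁻¹ * transformSup a F w) ^ r)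
      = (c ^ r)⁻¹ * cubeMean fun w => transformSup a F w ^ r := fun c hc => by
    rw [← smul_eq_mul, ← cubeMean_smul]
    congr 1
    funext w
    rw [Real.mul_rpow (by positivity) (hS0 w), Real.inv_rpow hc.le, smul_eq_mul]
  rw [hpow _ (by positivity), hpow _ (by positivity)] at h1
  have e12 : (12 * K) ^ r = 2 ^ r * (6 * K) ^ r := by
    rw [← Real.mul_rpow (by positivity) (by positivity)]
    congr 1
    ring
  have e24 : (24 : ℝ) ^ r * K ^ r = 2 ^ r * (12 * K) ^ r := by
    rw [← Real.mul_rpow (by positivity) (by positivity),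
      ← Real.mul_rpow (by positivity) (by positivity)]
    congr 1
    ring
  have h2 := doob_maximal hr hF0
  have h3 : cubeMean (fun w => ‖cubeTransform a N F w‖ ^ r)
      ≤ cubeMean fun w => transformSup a F w ^ r := cubeMean_mono fun w =>
    Real.rpow_le_rpow (norm_nonneg _)
      (le_partialSups_of_le (fun k => ‖cubeTransform a k F w‖) le_rfl) hr0.le
  set G := cubeMean fun w => transformSup a F w ^ r
  set S := cubeMean fun w => cubeSup (fun w => ‖F w‖) N w ^ r
  set Y := cubeMean fun w => ‖F w‖ ^ r
  have hp2 : (0 : ℝ) < 2 ^ r := by positivity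
  have hp6 : 0 < (6 * K) ^ r := by positivity
  have hp12 : 0 < (12 * K) ^ r := by positivity
  have hr1 : 0 < r - 1 := by linarith
  -- Passing from the level `12 * K` to `6 * K` costs a factor `2 ^ r`; with `δ = 2 ^ (-r) / 2` half
  -- of the left side remains after absorption.
  have h4 : G ≤ 2 * (12 * K) ^ r * S := by
    have : (2 ^ r : ℝ)⁻¹ / 2 * (((6 * K) ^ r)⁻¹ * G) = 2⁻¹ * (((12 * K) ^ r)⁻¹ * G) := by
      rw [e12]
      field_simp
    rw [this] at h1
    have h5 : ((12 * K) ^ r)⁻¹ * G ≤ 2 * S := by linarith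
    rw [inv_mul_le_iff₀ hp12] at h5
    linarith
  calc _ ≤ _ := h3
    _ ≤ _ := h4
    _ ≤ 2 * (12 * K) ^ r * (2 ^ r / (r - 1) * Y) := by gcongr
    _ = 2 * (2 ^ r * (12 * K) ^ r) / (r - 1) * Y := by ring
    _ = _ := by rw [← e24]; ring

/-- The constant in the extrapolation of the strong type inequality from a tail bound. -/
noncomputable def extrapolationConst (q r : ℝ) : ℝ :=
  (2 * 24 ^ r / (r - 1)) ^ (1 / r) * ((2 ^ r)⁻¹ / 2) ^ (-(1 / q))

lemma extrapolationConst_pos {q r : ℝ} (hr : 1 < r) : 0 < extrapolationConst q r := by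
  have hr1 : 0 < r - 1 := by linarith
  unfold extrapolationConst
  positivity

/-- A weak type inequality for bounded functions implies all the strong type inequalities. -/
lemma eLpNorm_cubeTransform_le {a : ℕ → E} {c q r : ℝ} (hc : 0 < c) (hq : 0 < q) (hr : 1 < r)
    (h : ∀ F : (Fin N → Bool) → ℂ, (∀ w, ‖F w‖ ≤ 1) →
      weakNorm (cubeMeasure N) q (fun w => ‖cubeTransform a N F w‖) ≤ ENNReal.ofReal c)
    (F : (Fin N → Bool) → ℂ) :
    eLpNorm (fun w => ‖cubeTransform a N F w‖) (ENNReal.ofReal r) (cubeMeasure N)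
      ≤ ENNReal.ofReal (extrapolationConst q r * c)
        * eLpNorm F (ENNReal.ofReal r) (cubeMeasure N) := by
  have hr0 : 0 < r := by linarith
  have hr1 : 0 < r - 1 := by linarith
  set δ : ℝ := (2 ^ r)⁻¹ / 2 with hδdef
  have hδ : 0 < δ := by positivity
  -- Chosen so that `K * δ ^ (1 / q) = c`: the weak bound at level `K` is then exactly a tail
  -- probability of at most `δ`.
  set K : ℝ := δ ^ (-(1 / q)) * c with hKdef
  have hK : 0 < K := by positivity
  have htail : CubeTailBound N a K δ := by
    intro F hF
    have h1 := (le_iSup (fun t : ℝ≥0 => (t : ℝ≥0∞)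
      * cubeMeasure N {ω | (t : ℝ) < |‖cubeTransform a N F ω‖|} ^ (1 / q)) K.toNNReal).trans
        (h F hF)
    simp only [Real.coe_toNNReal K hK.le, abs_norm, cubeMeasure_apply] at h1
    have hp0 := cubeProb_nonneg {w | K < ‖cubeTransform a N F w‖}
    rw [ENNReal.ofReal_rpow_of_nonneg hp0 (by positivity), ← ENNReal.ofReal,
      ← ENNReal.ofReal_mul hK.le, ENNReal.ofReal_le_ofReal_iff hc.le] at h1
    have hKδ : K * δ ^ (1 / q) = c := by
      rw [hKdef, mul_right_comm, ← Real.rpow_add hδ, neg_add_cancel, Real.rpow_zero, one_mul]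
    have h2 : cubeProb {w | K < ‖cubeTransform a N F w‖} ^ (1 / q) ≤ δ ^ (1 / q) :=
      le_of_mul_le_mul_left (h1.trans hKδ.ge) hK
    exact (Real.rpow_le_rpow_iff hp0 hδ.le (by positivity)).1 h2
  have hm0 : 0 ≤ cubeMean fun w => ‖F w‖ ^ r := cubeMean_nonneg fun w => by positivity
  rw [eLpNorm_cubeMeasure _ hr0, eLpNorm_cubeMeasure _ hr0, ← ENNReal.ofReal_mul
    (mul_pos (extrapolationConst_pos hr) hc).le]
  refine ENNReal.ofReal_le_ofReal ?_
  simp only [norm_norm]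
  calc _ ≤ (2 * 24 ^ r / (r - 1) * K ^ r * cubeMean fun w => ‖F w‖ ^ r) ^ (1 / r) :=
        Real.rpow_le_rpow (cubeMean_nonneg fun w => by positivity)
          (htail.cubeMean_rpow_le hK hr F) (by positivity)
    _ = _ := by
        rw [Real.mul_rpow (by positivity) hm0, Real.mul_rpow (by positivity) (by positivity),
          ← Real.rpow_mul hK.le, mul_one_div_cancel hr0.ne', Real.rpow_one, hKdef,
          extrapolationConst]
        ring

end CubeMeasure

/-! ### Atomic σ-algebras -/

section Atoms

variable {Ω : Type u} {𝒜 ℬ m : MeasurableSpace Ω} {P : Measure Ω} [IsProbabilityMeasure P]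

/-- The atoms are disjoint with total mass one, hence exhaust the space up to a null set. -/
lemma measureReal_eq_sum_inter_atoms (h𝒜 : 𝒜 ≤ m) {n : ℕ} (hn : n ≠ 0)
    {a : Fin n → Set Ω} (hd : Pairwise fun i i' => Disjoint (a i) (a i'))
    (ha : ∀ i, MeasurableSet[𝒜] (a i)) (hP : ∀ i, P (a i) = (n : ℝ≥0∞)⁻¹) {t : Set Ω}
    (ht : MeasurableSet t) : P.real t = ∑ i, P.real (t ∩ a i) := by
  have hU : P (⋃ i, a i) = 1 := by
    rw [measure_iUnion hd fun i => h𝒜 _ (ha i), tsum_fintype]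
    simp only [hP, Finset.sum_const, Finset.card_univ, Fintype.card_fin, nsmul_eq_mul]
    exact ENNReal.mul_inv_cancel (by exact_mod_cast hn) (ENNReal.natCast_ne_top n)
  have hUm : MeasurableSet (⋃ i, a i) := .iUnion fun i => h𝒜 _ (ha i)
  have h1 : P.real t = P.real (t ∩ ⋃ i, a i) := by
    rw [← measureReal_inter_add_sdiff hUm (s := t)]
    have : P.real (t \ ⋃ i, a i) = 0 := by
      rw [measureReal_def, measure_mono_null (fun x hx => hx.2)
        ((prob_compl_eq_zero_iff hUm).2 hU), ENNReal.toReal_zero]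
    rw [this, add_zero]
  rw [h1, Set.inter_iUnion, measureReal_iUnion_fintype
    (fun i j hij => ((hd hij).mono Set.inter_subset_right Set.inter_subset_right))
    fun i => ht.inter (h𝒜 _ (ha i))]

lemma HasEqualAtoms.measureReal_eq_zero_or_ge (h𝒜 : 𝒜 ≤ m) {n : ℕ}
    (hn : n ≠ 0) (h : HasEqualAtoms P 𝒜 n) {t : Set Ω} (ht : MeasurableSet[𝒜] t) :
    P.real t = 0 ∨ (n : ℝ)⁻¹ ≤ P.real t := by
  obtain ⟨a, hd, ha⟩ := h
  rw [or_iff_not_imp_left]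
  intro h0
  rw [measureReal_eq_sum_inter_atoms h𝒜 hn hd (fun i => (ha i).1) (fun i => (ha i).2.1)
    (h𝒜 _ ht)] at h0
  obtain ⟨i, -, hi⟩ := Finset.exists_ne_zero_of_sum_ne_zero h0
  rcases (ha i).2.2 (t ∩ a i) (ht.inter (ha i).1) Set.inter_subset_right with h1 | h1
  · exact absurd (by rw [measureReal_def, h1, ENNReal.toReal_zero]) hi
  · have h2 : P.real (t ∩ a i) = (n : ℝ)⁻¹ := by
      rw [measureReal_def, h1, (ha i).2.1, ENNReal.toReal_inv, ENNReal.toReal_natCast]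
    rw [← h2]
    exact measureReal_mono Set.inter_subset_left

/-- Each atom of `𝒜` meets some atom of `ℬ` in positive measure, hence contains it up to a null set,
and that atom has half the mass. Unite one such piece per atom of `𝒜`. A set of `𝒜` meets each atom
of `𝒜` in zero or full measure, so it is halved as well. -/
lemma HasEqualAtoms.exists_halving (h𝒜ℬ : 𝒜 ≤ ℬ) (hℬ : ℬ ≤ m) {n : ℕ}
    (hn : n ≠ 0) (h𝒜 : HasEqualAtoms P 𝒜 n) (h2 : HasEqualAtoms P ℬ (2 * n)) :
    ∃ B : Set Ω, MeasurableSet[ℬ] B ∧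
      ∀ s : Set Ω, MeasurableSet[𝒜] s → P.real (s ∩ B) = P.real s / 2 := by
  obtain ⟨a, had, ha⟩ := h𝒜
  obtain ⟨b, hbd, hb⟩ := h2
  have hareal : ∀ i, P.real (a i) = (n : ℝ)⁻¹ := fun i => by
    rw [measureReal_def, (ha i).2.1, ENNReal.toReal_inv, ENNReal.toReal_natCast]
  have hex : ∀ i, ∃ j, P.real (b j ∩ a i) = P.real (a i) / 2 := by
    intro i
    have h1 := measureReal_eq_sum_inter_atoms hℬ (by omega) hbd (fun i => (hb i).1)
      (fun i => (hb i).2.1) (h𝒜ℬ.trans hℬ _ (ha i).1)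
    have h0 : P.real (a i) ≠ 0 := by
      rw [hareal]
      positivity
    rw [h1] at h0
    obtain ⟨j, -, hj⟩ := Finset.exists_ne_zero_of_sum_ne_zero h0
    refine ⟨j, ?_⟩
    rw [Set.inter_comm] at hj
    rcases (hb j).2.2 (b j ∩ a i) ((hb j).1.inter (h𝒜ℬ _ (ha i).1)) Set.inter_subset_left
      with h3 | h3
    · exact absurd (by rw [measureReal_def, h3, ENNReal.toReal_zero]) hj
    · rw [hareal, measureReal_def, h3, (hb j).2.1, ENNReal.toReal_inv, ENNReal.toReal_natCast]
      push_cast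
      rw [mul_inv, mul_comm]
      rfl
  choose j hj using hex
  refine ⟨⋃ i, b (j i) ∩ a i, .iUnion fun i => (hb _).1.inter (h𝒜ℬ _ (ha i).1), fun s hs => ?_⟩
  have ham : ∀ i, MeasurableSet (a i) := fun i => hℬ _ (h𝒜ℬ _ (ha i).1)
  have hbm : ∀ i, MeasurableSet (b i) := fun i => hℬ _ (hb i).1
  have hsm : MeasurableSet s := hℬ _ (h𝒜ℬ _ hs)
  rw [measureReal_eq_sum_inter_atoms (h𝒜ℬ.trans hℬ) hn had (fun i => (ha i).1)
    (fun i => (ha i).2.1) hsm, measureReal_eq_sum_inter_atoms (h𝒜ℬ.trans hℬ) hn had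
    (fun i => (ha i).1) (fun i => (ha i).2.1)
    (hsm.inter (.iUnion fun i => (hbm (j i)).inter (ham i))), Finset.sum_div]
  refine Finset.sum_congr rfl fun i _ => ?_
  have e : (s ∩ ⋃ i, b (j i) ∩ a i) ∩ a i = (b (j i) ∩ a i) ∩ s := by
    ext x
    simp only [Set.mem_inter_iff, Set.mem_iUnion]
    constructor
    · rintro ⟨⟨h1, i', h2, h3⟩, h4⟩
      have : i' = i := by
        by_contra hne
        exact Set.disjoint_left.1 (had hne) h3 h4
      subst this
      exact ⟨⟨h2, h3⟩, h1⟩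
    · rintro ⟨⟨h1, h2⟩, h3⟩
      exact ⟨⟨h3, i, h1, h2⟩, h2⟩
  rw [e]
  rcases (ha i).2.2 (s ∩ a i) (hs.inter (ha i).1) Set.inter_subset_right with h1 | h1
  · have h0 : P.real (s ∩ a i) = 0 := by rw [measureReal_def, h1, ENNReal.toReal_zero]
    rw [h0, zero_div]
    refine le_antisymm ?_ measureReal_nonneg
    rw [← h0]
    exact measureReal_mono fun x hx => ⟨hx.2, hx.1.2⟩
  · have h0 : P.real (s ∩ a i) = P.real (a i) := by rw [measureReal_def, h1, measureReal_def]
    rw [h0, ← hj i, ← measureReal_inter_add_sdiff hsm (s := b (j i) ∩ a i)]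
    have h3 := measureReal_inter_add_sdiff (μ := P) hsm (s := a i)
    rw [Set.inter_comm, h0] at h3
    have h4 : P.real ((b (j i) ∩ a i) \ s) ≤ P.real (a i \ s) :=
      measureReal_mono fun x hx => ⟨hx.1.2, hx.2⟩
    linarith [measureReal_nonneg (μ := P) (s := (b (j i) ∩ a i) \ s)]

end Atoms

/-! ### Coordinates on a dyadic space and transfer to the cube -/

namespace DyadicSpace

variable (X : DyadicSpace.{u})

lemma exists_halving (k : ℕ) : ∃ B : Set X.Ω, MeasurableSet[X.filt (k + 1)] B ∧
    ∀ s : Set X.Ω, MeasurableSet[X.filt k] s → X.P.real (s ∩ B) = X.P.real s / 2 :=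
  HasEqualAtoms.exists_halving (X.filt.mono k.le_succ) (X.filt.le _) (by positivity)
    (X.dyadic k) (by rw [← pow_succ']; exact X.dyadic (k + 1))

/-- A set of `Σ_{k+1}` that halves each set of `Σ_k`. -/
def half (k : ℕ) : Set X.Ω := (X.exists_halving k).choose

lemma measurableSet_half (k : ℕ) : MeasurableSet[X.filt (k + 1)] (X.half k) :=
  (X.exists_halving k).choose_spec.1

lemma measureReal_inter_half {k : ℕ} {s : Set X.Ω} (hs : MeasurableSet[X.filt k] s) :
    X.P.real (s ∩ X.half k) = X.P.real s / 2 :=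
  (X.exists_halving k).choose_spec.2 s hs

open Classical in
/-- Coordinates on a dyadic space. -/
noncomputable def coord (N : ℕ) (ω : X.Ω) : Fin N → Bool := fun i => decide (ω ∈ X.half i)

/-- The set where the first `n` coordinates are those of `w`. -/
def cell {N : ℕ} (n : ℕ) (w : Fin N → Bool) : Set X.Ω :=
  {ω | ∀ i : Fin N, (i : ℕ) < n → X.coord N ω i = w i}

variable {N : ℕ}

lemma cell_zero (w : Fin N → Bool) : X.cell 0 w = Set.univ := by
  ext; simp [cell]

lemma cell_eq_preimage (w : Fin N → Bool) : X.cell N w = X.coord N ⁻¹' {w} := by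
  ext ω
  simp [cell, funext_iff]

lemma cell_merge (n : ℕ) (w v : Fin N → Bool) : X.cell n (cubeMerge n w v) = X.cell n w := by
  ext ω
  simp only [cell, Set.mem_ofPred_eq]
  refine forall₂_congr fun i hi => ?_
  rw [cubeMerge, if_pos hi]

lemma cell_succ {n : ℕ} (hn : n < N) (w : Fin N → Bool) :
    X.cell (n + 1) w = X.cell n w ∩ (if w ⟨n, hn⟩ then X.half n else (X.half n)ᶜ) := by
  ext ω
  have h : ω ∈ X.cell (n + 1) w ↔ ω ∈ X.cell n w ∧ X.coord N ω ⟨n, hn⟩ = w ⟨n, hn⟩ := by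
    simp only [cell, Set.mem_ofPred_eq]
    constructor
    · exact fun h => ⟨fun i hi => h i (by omega), h _ (Nat.lt_succ_self n)⟩
    · rintro ⟨h1, h2⟩ i hi
      rcases (by omega : (i : ℕ) < n ∨ (i : ℕ) = n) with h3 | h3
      · exact h1 i h3
      · have : i = ⟨n, hn⟩ := Fin.ext h3
        rw [this, h2]
  rw [h, Set.mem_inter_iff]
  refine and_congr_right fun _ => ?_
  cases w ⟨n, hn⟩ <;> simp [coord]

lemma measurableSet_cell {n : ℕ} (hn : n ≤ N) (w : Fin N → Bool) :
    MeasurableSet[X.filt n] (X.cell n w) := by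
  induction n with
  | zero => rw [cell_zero]; exact MeasurableSet.univ
  | succ n ih =>
    rw [X.cell_succ hn]
    refine (X.filt.mono n.le_succ _ (ih (by omega))).inter ?_
    split_ifs
    · exact X.measurableSet_half n
    · exact (X.measurableSet_half n).compl

/-- The coordinates from `k` on are fair and independent of `Σ_k`: each further one halves the set
obtained so far. -/
lemma measureReal_inter_cell {k n : ℕ} (hkn : k ≤ n) (hn : n ≤ N) (w : Fin N → Bool) {s : Set X.Ω}
    (hs : MeasurableSet[X.filt k] s) :
    X.P.real (s ∩ X.cell n w) = (2 ^ (n - k))⁻¹ * X.P.real (s ∩ X.cell k w) := by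
  induction n, hkn using Nat.le_induction with
  | base => simp
  | succ n hkn ih =>
    have ih := ih (by omega)
    have hm : MeasurableSet[X.filt n] (s ∩ X.cell n w) :=
      (X.filt.mono hkn _ hs).inter (X.measurableSet_cell (by omega) w)
    have h1 := X.measureReal_inter_half hm
    have h2 := measureReal_inter_add_sdiff (μ := X.P) (s := s ∩ X.cell n w)
      (X.filt.le _ _ (X.measurableSet_half n))
    have h3 : X.P.real (s ∩ X.cell (n + 1) w) = X.P.real (s ∩ X.cell n w) / 2 := by
      rw [X.cell_succ hn, ← Set.inter_assoc]
      split_ifs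
      · exact h1
      · rw [← Set.sdiff_eq]
        linarith
    rw [h3, ih, Nat.succ_sub hkn, pow_succ, mul_inv]
    ring

lemma measureReal_preimage_coord (w : Fin N → Bool) :
    X.P.real (X.coord N ⁻¹' {w}) = (2 ^ N)⁻¹ := by
  have h := X.measureReal_inter_cell N.zero_le le_rfl w MeasurableSet.univ
  rw [cell_zero, Set.univ_inter, cell_eq_preimage] at h
  simpa using h

lemma measurable_coord {k : ℕ} (hk : N ≤ k) : Measurable[X.filt k] (X.coord N) := by
  refine @measurable_to_countable' (Fin N → Bool) X.Ω _ _ (X.filt k) _ fun w => ?_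
  rw [← cell_eq_preimage]
  exact X.filt.mono hk _ (X.measurableSet_cell le_rfl w)

lemma measurable_coord' : Measurable (X.coord N) :=
  (X.measurable_coord le_rfl).mono (X.filt.le N) le_rfl

lemma map_coord : X.P.map (X.coord N) = cubeMeasure N := by
  refine Measure.ext_of_singleton fun w => ?_
  rw [Measure.map_apply X.measurable_coord' (measurableSet_singleton w), cubeMeasure,
    Measure.smul_apply, Measure.count_singleton, smul_eq_mul, mul_one,
    ← X.measureReal_preimage_coord w, ofReal_measureReal]

lemma integrable_comp_coord (F : (Fin N → Bool) → ℂ) : Integrable (fun ω => F (X.coord N ω)) X.P :=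
  (Integrable.of_finite (f := F) (μ := X.P.map (X.coord N))).comp_measurable X.measurable_coord'

lemma setIntegral_comp_coord (F : (Fin N → Bool) → ℂ) (s : Set X.Ω) :
    ∫ ω in s, F (X.coord N ω) ∂X.P = ∑ w, X.P.real (s ∩ X.cell N w) • F w := by
  rw [← integral_map (f := F) X.measurable_coord'.aemeasurable
    (Measurable.of_discrete).aestronglyMeasurable, integral_fintype Integrable.of_finite]
  refine Finset.sum_congr rfl fun w _ => ?_
  rw [measureReal_def, Measure.map_apply X.measurable_coord' (measurableSet_singleton w),
    Measure.restrict_apply (X.measurable_coord' (measurableSet_singleton w)), cell_eq_preimage,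
    measureReal_def, Set.inter_comm]

lemma measurable_determined_comp_coord {k : ℕ} {F : (Fin N → Bool) → ℂ}
    (hF : CubeDetermined k F) : Measurable[X.filt k] fun ω => F (X.coord N ω) := by
  -- Only `coord k` is known to be measurable for `Σ_k`, so `F` is factored through it; the
  -- remaining coordinates are irrelevant and set to `false`.
  have h : (fun ω => F (X.coord N ω)) = (fun v : Fin k → Bool =>
      F fun i => if hi : (i : ℕ) < k then v ⟨i, hi⟩ else false) ∘ X.coord k := by
    funext ω
    rw [← hF _ fun _ => false]
    simp only [Function.comp_apply]
    rfl
  rw [h]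
  exact (Measurable.of_discrete).comp (X.measurable_coord le_rfl)

/-- Conditional expectations of functions of the coordinates. -/
lemma condExp_comp_coord {k : ℕ} (hk : k ≤ N) (F : (Fin N → Bool) → ℂ) :
    X.P[fun ω => F (X.coord N ω) | X.filt k] =ᵐ[X.P] fun ω => cubeExp k F (X.coord N ω) := by
  refine (ae_eq_condExp_of_forall_setIntegral_eq (X.filt.le k) (X.integrable_comp_coord F)
    (fun s _ _ => (X.integrable_comp_coord _).integrableOn) (fun s hs _ => ?_)
    (X.measurable_determined_comp_coord
      (cubeExp_determined k F)).stronglyMeasurable.aestronglyMeasurable).symm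
  rw [X.setIntegral_comp_coord, X.setIntegral_comp_coord]
  -- For `s` in `Σ_k` the mass of `s` in a cell depends only on the first `k` coordinates, so it can
  -- be pulled out of the conditional expectation.
  have hdet : CubeDetermined k fun w : Fin N → Bool => X.P.real (s ∩ X.cell N w) := fun w v => by
    simp only
    rw [X.measureReal_inter_cell hk le_rfl _ hs, X.measureReal_inter_cell hk le_rfl _ hs,
      cell_merge]
  have h := cubeMean_cubeExp k fun w : Fin N → Bool => X.P.real (s ∩ X.cell N w) • F w
  rw [funext (hdet.cubeExp_smul F), cubeMean, cubeMean] at h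
  exact smul_right_injective ℂ (by positivity : ((2 : ℝ) ^ N)⁻¹ ≠ 0) h

/-- Each `Σ_N`-measurable function is a function of the coordinates. -/
lemma exists_condExp_eq_comp_coord (N : ℕ) {f : X.Ω → ℂ} (hf : Integrable f X.P) :
    ∃ F : (Fin N → Bool) → ℂ, X.P[f | X.filt N] =ᵐ[X.P] fun ω => F (X.coord N ω) := by
  set F : (Fin N → Bool) → ℂ := fun w => (2 : ℝ) ^ N • ∫ ω in X.cell N w, f ω ∂X.P with hFdef
  refine ⟨F, ?_⟩
  refine (ae_eq_condExp_of_forall_setIntegral_eq (X.filt.le N) hf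
    (fun s _ _ => (X.integrable_comp_coord F).integrableOn) (fun s hs _ => ?_)
    (X.measurable_determined_comp_coord
      (cubeDetermined_of_ge le_rfl F)).stronglyMeasurable.aestronglyMeasurable).symm
  have hsm := X.filt.le N _ hs
  have hcm : ∀ w : Fin N → Bool, MeasurableSet (X.cell N w) := fun w =>
    X.filt.le N _ (X.measurableSet_cell le_rfl w)
  rw [X.setIntegral_comp_coord]
  have hU : s = ⋃ w : Fin N → Bool, s ∩ X.cell N w := by
    ext ω
    simp [cell_eq_preimage]
  conv_rhs => rw [hU]
  rw [integral_iUnion_fintype (fun w => hsm.inter (hcm w)) (fun w w' hww' => ?_)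
    fun w => hf.integrableOn]
  · refine Finset.sum_congr rfl fun w _ => ?_
    have hPc : X.P.real (X.cell N w) = (2 ^ N)⁻¹ := by
      rw [cell_eq_preimage, measureReal_preimage_coord]
    -- A cell has the mass `2 ^ (-N)` of one atom, so `s` meets it in zero or full measure.
    rcases (X.dyadic N).measureReal_eq_zero_or_ge (X.filt.le N) (by positivity)
      (hs.inter (X.measurableSet_cell le_rfl w)) with h0 | h1
    · rw [h0, zero_smul, setIntegral_measure_zero]
      exact (measureReal_eq_zero_iff).1 h0
    · have h2 : X.P.real (s ∩ X.cell N w) = (2 ^ N)⁻¹ := by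
        refine le_antisymm ?_ (by push_cast at h1; exact h1)
        rw [← hPc]
        exact measureReal_mono Set.inter_subset_right
      rw [h2, smul_smul, inv_mul_cancel₀ (by positivity), one_smul]
      refine setIntegral_congr_set ?_
      refine (ae_eq_of_subset_of_measure_ge Set.inter_subset_right ?_
        (hsm.inter (hcm w)).nullMeasurableSet (measure_ne_top _ _)).symm
      rw [← ofReal_measureReal, ← ofReal_measureReal, hPc, h2]
  · simp only [Function.onFun, cell_eq_preimage]
    refine Disjoint.mono Set.inter_subset_right Set.inter_subset_right ?_
    exact Disjoint.preimage _ (Set.disjoint_singleton.2 hww')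

/-- The columns of a matrix, continued by zero. -/
def _root_.matrixColumns {M N : ℕ} (A : Matrix (Fin M) (Fin N) ℂ) (k : ℕ) : Fin M → ℂ :=
  fun j => if h : k < N then A j ⟨k, h⟩ else 0

variable {M : ℕ} (A : Matrix (Fin M) (Fin N) ℂ)

/-- The maximum over rows is absorbed into the sup norm, leaving one vector-valued transform. -/
lemma maximal_eq_norm_sum (f : X.Ω → ℂ) (ω : X.Ω) :
    X.maximal A f ω = ‖∑ k ∈ Finset.range N, (X.P[f | X.filt (k + 1)] ω - X.P[f | X.filt k] ω) •
      matrixColumns A k‖ := by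
  rw [maximal]
  congr 1
  funext j
  rw [Finset.sum_apply, Finset.sum_range]
  refine Finset.sum_congr rfl fun k _ => ?_
  simp [delta, matrixColumns, mul_comm]

lemma maximal_ae_eq {f : X.Ω → ℂ} (F : (Fin N → Bool) → ℂ)
    (hf : X.P[f | X.filt N] =ᵐ[X.P] fun ω => F (X.coord N ω)) :
    X.maximal A f =ᵐ[X.P] fun ω => ‖cubeTransform (matrixColumns A) N F (X.coord N ω)‖ := by
  have h : ∀ k ≤ N, X.P[f | X.filt k] =ᵐ[X.P] fun ω => cubeExp k F (X.coord N ω) := fun k hk =>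
    (condExp_condExp_of_le (X.filt.mono hk) (X.filt.le N)).symm.trans
      ((condExp_congr_ae hf).trans (X.condExp_comp_coord hk F))
  have hall : ∀ᵐ ω ∂X.P, ∀ k, k ≤ N → X.P[f | X.filt k] ω = cubeExp k F (X.coord N ω) := by
    rw [ae_all_iff]
    intro k
    by_cases hk : k ≤ N
    · filter_upwards [h k hk] with ω hω _ using hω
    · exact Filter.Eventually.of_forall fun ω hk' => absurd hk' hk
  filter_upwards [hall] with ω hω
  rw [maximal_eq_norm_sum, cubeTransform]
  congr 1
  refine Finset.sum_congr rfl fun k hk => ?_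
  have hk := Finset.mem_range.1 hk
  rw [hω k hk.le, hω (k + 1) hk]

lemma eLpNorm_comp_coord {V : Type*} [NormedAddCommGroup V] (F : (Fin N → Bool) → V) (p : ℝ≥0∞) :
    eLpNorm (fun ω => F (X.coord N ω)) p X.P = eLpNorm F p (cubeMeasure N) := by
  rw [← X.map_coord, eLpNorm_map_measure (StronglyMeasurable.of_discrete).aestronglyMeasurable
    X.measurable_coord'.aemeasurable]
  rfl

lemma weakNorm_comp_coord (F : (Fin N → Bool) → ℝ) (p : ℝ) :
    weakNorm X.P p (fun ω => F (X.coord N ω)) = weakNorm (cubeMeasure N) p F := by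
  simp only [weakNorm, ← X.map_coord]
  refine iSup_congr fun t => ?_
  rw [Measure.map_apply X.measurable_coord' MeasurableSet.of_discrete]
  rfl

/-- The inequalities for the maximal function can be tested on the cube. -/
lemma forall_maximal_le_iff {p : ℝ} (hp : 1 ≤ p) {Φ : (X.Ω → ℝ) → ℝ≥0∞}
    {Ψ : ((Fin N → Bool) → ℝ) → ℝ≥0∞}
    (hΦ : ∀ g (G : (Fin N → Bool) → ℝ), g =ᵐ[X.P] (fun ω => G (X.coord N ω)) → Φ g = Ψ G)
    (c : ℝ≥0∞) :
    (∀ f : X.Ω → ℂ, MemLp f (ENNReal.ofReal p) X.P →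
      Φ (X.maximal A f) ≤ c * eLpNorm f (ENNReal.ofReal p) X.P) ↔
    ∀ F : (Fin N → Bool) → ℂ, Ψ (fun w => ‖cubeTransform (matrixColumns A) N F w‖)
      ≤ c * eLpNorm F (ENNReal.ofReal p) (cubeMeasure N) := by
  have hp1 : 1 ≤ ENNReal.ofReal p := by simpa using hp
  constructor
  · intro h F
    have h1 := X.maximal_ae_eq A F (f := fun ω => F (X.coord N ω)) (by
      refine (X.condExp_comp_coord le_rfl F).trans (Filter.Eventually.of_forall fun ω => ?_)
      exact cubeExp_of_ge le_rfl F _)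
    have hmem : MemLp (fun ω => F (X.coord N ω)) (ENNReal.ofReal p) X.P :=
      (MemLp.of_discrete (f := F) (μ := X.P.map (X.coord N))).comp_of_map
        X.measurable_coord'.aemeasurable
    have h2 := h _ hmem
    rw [hΦ _ (fun w => ‖cubeTransform (matrixColumns A) N F w‖) h1, eLpNorm_comp_coord] at h2
    exact h2
  · intro h f hf
    obtain ⟨F, hF⟩ := X.exists_condExp_eq_comp_coord N (hf.integrable hp1)
    rw [hΦ _ (fun w => ‖cubeTransform (matrixColumns A) N F w‖) (X.maximal_ae_eq A F hF)]
    refine (h F).trans ?_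
    gcongr
    -- Replacing `f` by its conditional expectation given `Σ_N` keeps the maximal function and does
    -- not increase the norm.
    rw [← X.eLpNorm_comp_coord, ← eLpNorm_congr_ae hF]
    exact eLpNorm_condExp_le_eLpNorm f hp1

lemma eLpNorm_eq_of_ae_eq_comp_coord {g : X.Ω → ℝ} {G : (Fin N → Bool) → ℝ} (p : ℝ≥0∞)
    (h : g =ᵐ[X.P] fun ω => G (X.coord N ω)) :
    eLpNorm g p X.P = eLpNorm G p (cubeMeasure N) := by
  rw [eLpNorm_congr_ae h, eLpNorm_comp_coord]

lemma weakNorm_eq_of_ae_eq_comp_coord {g : X.Ω → ℝ} {G : (Fin N → Bool) → ℝ} (p : ℝ)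
    (h : g =ᵐ[X.P] fun ω => G (X.coord N ω)) :
    weakNorm X.P p g = weakNorm (cubeMeasure N) p G := by
  rw [← X.weakNorm_comp_coord]
  refine iSup_congr fun t => ?_
  congr 2
  refine measure_congr ?_
  filter_upwards [h] with ω hω
  change ((t : ℝ) < |g ω|) = ((t : ℝ) < |G (X.coord N ω)|)
  rw [hω]

end DyadicSpace

/-! ### The constants on the cube -/

section CubeConstants

variable {N : ℕ}

lemma weakNorm_le_eLpNorm (G : (Fin N → Bool) → ℝ) {p : ℝ} (hp : 0 < p) :
    weakNorm (cubeMeasure N) p G ≤ eLpNorm G (ENNReal.ofReal p) (cubeMeasure N) := by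
  refine iSup_le fun t => ?_
  have h := mul_meas_ge_le_pow_eLpNorm' (p := ENNReal.ofReal p) (cubeMeasure N) (by simpa using hp)
    ENNReal.ofReal_ne_top (StronglyMeasurable.of_discrete (f := G)).aestronglyMeasurable t
  rw [ENNReal.toReal_ofReal hp.le] at h
  have h2 := ENNReal.rpow_le_rpow h (by positivity : 0 ≤ 1 / p)
  rw [ENNReal.mul_rpow_of_nonneg _ _ (by positivity), ← ENNReal.rpow_mul, ← ENNReal.rpow_mul,
    mul_one_div_cancel hp.ne', ENNReal.rpow_one, ENNReal.rpow_one] at h2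
  refine le_trans ?_ h2
  gcongr with w
  intro hw
  rw [← Real.norm_eq_abs] at hw
  rw [enorm_eq_nnnorm, ENNReal.coe_le_coe]
  exact hw.le

variable {E : Type*} [NormedAddCommGroup E] [NormedSpace ℂ E] (a : ℕ → E)

/-- The constants with which `F` satisfies the strong type inequality from `L_p` to `L_q`. -/
def cubeStrongBounds (N : ℕ) (p q : ℝ) : Set ℝ≥0∞ :=
  {c | ∀ F : (Fin N → Bool) → ℂ,
    eLpNorm (fun w => ‖cubeTransform a N F w‖) (ENNReal.ofReal q) (cubeMeasure N)
      ≤ c * eLpNorm F (ENNReal.ofReal p) (cubeMeasure N)}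

/-- The constants in the weak type inequality on the cube. -/
def cubeWeakBounds (N : ℕ) (p : ℝ) : Set ℝ≥0∞ :=
  {c | ∀ F : (Fin N → Bool) → ℂ, weakNorm (cubeMeasure N) p (fun w => ‖cubeTransform a N F w‖)
      ≤ c * eLpNorm F (ENNReal.ofReal p) (cubeMeasure N)}

lemma cubeExp_le_pow_mul_cubeMean {F : (Fin N → Bool) → ℝ} (h : ∀ w, 0 ≤ F w) (n : ℕ)
    (w : Fin N → Bool) : cubeExp n F w ≤ 2 ^ n * cubeMean F := by
  induction n with
  | zero => simp [cubeExp, cubeMerge_zero]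
  | succ n ih =>
    have := cubeExp_succ_le_two_mul h n w
    rw [pow_succ]
    linarith

/-- Crude bound: a conditional mean at level `k` is at most `2 ^ k` times the mean, so the transform
is bounded pointwise by a multiple of the `L_1` norm. -/
lemma exists_mem_cubeStrongBounds (N : ℕ) {p : ℝ} (hp : 1 ≤ p) (q : ℝ) :
    ∃ c ∈ cubeStrongBounds a N p q, c < ∞ := by
  set C : ℝ := ∑ k ∈ Finset.range N, (2 ^ (k + 1) + 2 ^ k) * ‖a k‖ with hC
  have hC0 : 0 ≤ C := by positivity
  refine ⟨ENNReal.ofReal C, fun F => ?_, ENNReal.ofReal_lt_top⟩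
  have hF0 : ∀ w, 0 ≤ ‖F w‖ := fun w => norm_nonneg _
  have hbound : ∀ w, ‖cubeTransform a N F w‖ ≤ C * cubeMean fun w => ‖F w‖ := by
    intro w
    rw [hC, Finset.sum_mul]
    refine norm_sum_le_of_le _ fun k _ => ?_
    rw [norm_smul, mul_right_comm]
    gcongr
    refine (norm_sub_le _ _).trans ?_
    rw [add_mul]
    exact add_le_add
      ((norm_cubeExp_le _ F w).trans (cubeExp_le_pow_mul_cubeMean hF0 (k + 1) w))
      ((norm_cubeExp_le _ F w).trans (cubeExp_le_pow_mul_cubeMean hF0 k w))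
  calc _ ≤ ENNReal.ofReal (C * cubeMean fun w => ‖F w‖) := by
        have h1 := eLpNorm_le_of_ae_bound (μ := cubeMeasure N) (p := ENNReal.ofReal q)
          (f := fun w => ‖cubeTransform a N F w‖)
          (Filter.Eventually.of_forall fun w => by rw [norm_norm]; exact hbound w)
        simpa using h1
    _ = ENNReal.ofReal C * eLpNorm F (ENNReal.ofReal 1) (cubeMeasure N) := by
        rw [eLpNorm_cubeMeasure F one_pos, ENNReal.ofReal_mul hC0]
        simp
    _ ≤ _ := by
        gcongr
        exact eLpNorm_le_eLpNorm_of_exponent_le (ENNReal.ofReal_le_ofReal hp)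
          (StronglyMeasurable.of_discrete).aestronglyMeasurable

lemma cubeStrongBounds_subset_cubeWeakBounds {p : ℝ} (hp : 0 < p) :
    cubeStrongBounds a N p p ⊆ cubeWeakBounds a N p :=
  fun _ hc F => (weakNorm_le_eLpNorm _ hp).trans (hc F)

lemma cubeStrongBounds_mono {p q r : ℝ} (h : q ≤ r) :
    cubeStrongBounds a N p r ⊆ cubeStrongBounds a N p q :=
  fun _ hc F => (eLpNorm_le_eLpNorm_of_exponent_le (ENNReal.ofReal_le_ofReal h)
    (StronglyMeasurable.of_discrete).aestronglyMeasurable).trans (hc F)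

lemma eLpNorm_cubeMeasure_le_one {F : (Fin N → Bool) → ℂ} (hF : ∀ w, ‖F w‖ ≤ 1) (p : ℝ≥0∞) :
    eLpNorm F p (cubeMeasure N) ≤ 1 := by
  simpa using eLpNorm_le_of_ae_bound (μ := cubeMeasure N) (p := p) (Filter.Eventually.of_forall hF)

lemma sInf_cubeStrongBounds_le {q r : ℝ} (hq : 0 < q) (hr : 1 < r) {S : Set ℝ≥0∞}
    (hS : ∀ c ∈ S, ∀ F : (Fin N → Bool) → ℂ, (∀ w, ‖F w‖ ≤ 1) →
      weakNorm (cubeMeasure N) q (fun w => ‖cubeTransform a N F w‖) ≤ c) :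
    sInf (cubeStrongBounds a N r r) ≤ ENNReal.ofReal (extrapolationConst q r) * sInf S := by
  have hC := extrapolationConst_pos (q := q) hr
  rw [← ENNReal.div_le_iff' (by simpa using hC) ENNReal.ofReal_ne_top]
  -- Working with `c` strictly above the infimum avoids attainment and provides the positive
  -- constant that the extrapolation needs, even if the infimum is zero.
  refine le_of_forall_gt_imp_ge_of_dense fun c hc => ?_
  rw [ENNReal.div_le_iff' (by simpa using hC) ENNReal.ofReal_ne_top]
  obtain ⟨b, hb, hbc⟩ := sInf_lt_iff.1 hc
  rcases eq_or_ne c ∞ with rfl | hct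
  · rw [ENNReal.mul_top (by simpa using hC)]
    exact le_top
  · have hc0 : 0 < c.toReal := ENNReal.toReal_pos (ne_bot_of_gt hbc) hct
    refine sInf_le fun F => ?_
    have := eLpNorm_cubeTransform_le hc0 hq hr
      (fun F hF => ((hS b hb F hF).trans hbc.le).trans (ENNReal.ofReal_toReal hct).ge) F
    rwa [ENNReal.ofReal_mul hC.le, ENNReal.ofReal_toReal hct] at this

lemma sInf_cubeStrongBounds_le_weak {q r : ℝ} (hq : 0 < q) (hr : 1 < r) :
    sInf (cubeStrongBounds a N r r)
      ≤ ENNReal.ofReal (extrapolationConst q r) * sInf (cubeWeakBounds a N q) :=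
  sInf_cubeStrongBounds_le a hq hr fun _ hc F hF =>
    (hc F).trans (mul_le_of_le_one_right' (eLpNorm_cubeMeasure_le_one hF _))

/-- For functions bounded by one the `L_p` norm is at most one whatever `p` is, so only the target
exponent `q` enters the constant. -/
lemma sInf_cubeStrongBounds_le_mixed {p q r : ℝ} (hq : 0 < q) (hr : 1 < r) :
    sInf (cubeStrongBounds a N r r)
      ≤ ENNReal.ofReal (extrapolationConst q r) * sInf (cubeStrongBounds a N p q) :=
  sInf_cubeStrongBounds_le a hq hr fun _ hc F hF => (weakNorm_le_eLpNorm _ hq).trans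
    ((hc F).trans (mul_le_of_le_one_right' (eLpNorm_cubeMeasure_le_one hF _)))

end CubeConstants

/-! ### Comparison of the constants and the theorem -/

namespace DyadicSpace

variable (X : DyadicSpace.{u}) {M N : ℕ} (A : Matrix (Fin M) (Fin N) ℂ)

lemma mixedConst_eq {p : ℝ} (hp : 1 ≤ p) (q : ℝ) :
    X.mixedConst p q A = sInf (cubeStrongBounds (matrixColumns A) N p q) :=
  congrArg sInf (Set.ext (X.forall_maximal_le_iff A hp
    fun _ _ h => X.eLpNorm_eq_of_ae_eq_comp_coord (ENNReal.ofReal q) h))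

lemma strongConst_eq {p : ℝ} (hp : 1 ≤ p) :
    X.strongConst p A = sInf (cubeStrongBounds (matrixColumns A) N p p) :=
  X.mixedConst_eq A hp p

lemma weakConst_eq {p : ℝ} (hp : 1 ≤ p) :
    X.weakConst p A = sInf (cubeWeakBounds (matrixColumns A) N p) :=
  congrArg sInf (Set.ext (X.forall_maximal_le_iff A hp
    fun _ _ h => X.weakNorm_eq_of_ae_eq_comp_coord p h))

lemma mixedConst_lt_top {p : ℝ} (hp : 1 ≤ p) (q : ℝ) : X.mixedConst p q A < ∞ := by
  obtain ⟨c, hc, hct⟩ := exists_mem_cubeStrongBounds (matrixColumns A) N hp q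
  rw [X.mixedConst_eq A hp]
  exact (sInf_le hc).trans_lt hct

lemma weakConst_le_strongConst {p : ℝ} (hp : 1 ≤ p) : X.weakConst p A ≤ X.strongConst p A := by
  rw [X.weakConst_eq A hp, X.strongConst_eq A hp]
  exact sInf_le_sInf (cubeStrongBounds_subset_cubeWeakBounds _ (by linarith))

lemma mixedConst_le_strongConst {p q : ℝ} (hp : 1 ≤ p) (hq : q ≤ p) :
    X.mixedConst p q A ≤ X.strongConst p A := by
  rw [X.mixedConst_eq A hp, X.strongConst_eq A hp]
  exact sInf_le_sInf (cubeStrongBounds_mono _ hq)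

lemma strongConst_le_weakConst {q r : ℝ} (hq : 1 ≤ q) (hr : 1 < r) :
    X.strongConst r A ≤ ENNReal.ofReal (extrapolationConst q r) * X.weakConst q A := by
  rw [X.weakConst_eq A hq, X.strongConst_eq A hr.le]
  exact sInf_cubeStrongBounds_le_weak _ (by linarith) hr

lemma strongConst_le_mixedConst {p q r : ℝ} (hp : 1 ≤ p) (hq : 0 < q) (hr : 1 < r) :
    X.strongConst r A ≤ ENNReal.ofReal (extrapolationConst q r) * X.mixedConst p q A := by
  rw [X.mixedConst_eq A hp, X.strongConst_eq A hr.le]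
  exact sInf_cubeStrongBounds_le_mixed _ hq hr

lemma strongConst_le_strongConst {q r : ℝ} (hq : 1 ≤ q) (hr : 1 < r) :
    X.strongConst r A ≤ ENNReal.ofReal (extrapolationConst q r) * X.strongConst q A :=
  (X.strongConst_le_weakConst A hq hr).trans (by gcongr; exact X.weakConst_le_strongConst A hq)

end DyadicSpace

theorem theorem2p1 :
    -- the constants are finite and do not depend on the dyadic space
    (∀ (p : ℝ), 1 ≤ p → ∀ (M N : ℕ) (A : Matrix (Fin M) (Fin N) ℂ)
      (X : DyadicSpace.{u}) (Y : DyadicSpace.{v}),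
        (X.strongConst p A < ∞ ∧ X.strongConst p A = Y.strongConst p A) ∧
        (X.weakConst p A < ∞ ∧ X.weakConst p A = Y.weakConst p A) ∧
        ∀ q : ℝ, 0 < q → q < p →
          X.mixedConst p q A < ∞ ∧ X.mixedConst p q A = Y.mixedConst p q A) ∧
    -- equivalence of the strong and the weak constants
    (∀ p q : ℝ, 1 < p → 1 < q → ∃ C : ℝ≥0, 0 < C ∧
      ∀ (M N : ℕ) (A : Matrix (Fin M) (Fin N) ℂ) (X : DyadicSpace.{u}),
        (C : ℝ≥0∞)⁻¹ * X.strongConst p A ≤ X.weakConst q A ∧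
        X.weakConst q A ≤ X.strongConst q A ∧
        X.strongConst q A ≤ C * X.strongConst p A) ∧
    -- equivalence of the mixed constants with `h(A) = h_2(A)`
    (∀ p q : ℝ, 0 < q → q < p → 1 < p → ∃ C : ℝ≥0, 0 < C ∧
      ∀ (M N : ℕ) (A : Matrix (Fin M) (Fin N) ℂ) (X : DyadicSpace.{u}),
        (C : ℝ≥0∞)⁻¹ * X.strongConst 2 A ≤ X.mixedConst p q A ∧
        X.mixedConst p q A ≤ C * X.strongConst 2 A) := by
  refine ⟨fun p hp M N A X Y => ⟨⟨X.mixedConst_lt_top A hp p, ?_⟩, ⟨?_, ?_⟩, fun q _ _ =>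
    ⟨X.mixedConst_lt_top A hp q, ?_⟩⟩, fun p q hp hq => ?_, fun p q hq hqp hp => ?_⟩
  · rw [X.strongConst_eq A hp, Y.strongConst_eq A hp]
  · exact (X.weakConst_le_strongConst A hp).trans_lt (X.mixedConst_lt_top A hp p)
  · rw [X.weakConst_eq A hp, Y.weakConst_eq A hp]
  · rw [X.mixedConst_eq A hp, Y.mixedConst_eq A hp]
  · have h1 := Real.toNNReal_pos.2 (extrapolationConst_pos (q := q) hp)
    -- One constant for both directions: the sum dominates each extrapolation constant.
    refine ⟨(extrapolationConst q p).toNNReal + (extrapolationConst p q).toNNReal,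
      add_pos_of_pos_of_nonneg h1 zero_le, fun M N A X =>
      ⟨?_, X.weakConst_le_strongConst A hq.le, ?_⟩⟩
    · rw [ENNReal.inv_mul_le_iff (by exact_mod_cast (add_pos_of_pos_of_nonneg h1 zero_le).ne')
        ENNReal.coe_ne_top]
      refine (X.strongConst_le_weakConst A hq.le hp).trans ?_
      gcongr
      exact ENNReal.coe_le_coe.2 le_self_add
    · refine (X.strongConst_le_strongConst A hp.le hq).trans ?_
      gcongr
      exact ENNReal.coe_le_coe.2 le_add_self
  · have h1 := Real.toNNReal_pos.2 (extrapolationConst_pos (q := q) one_lt_two)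
    refine ⟨(extrapolationConst q 2).toNNReal + (extrapolationConst 2 p).toNNReal,
      add_pos_of_pos_of_nonneg h1 zero_le, fun M N A X => ⟨?_, ?_⟩⟩
    · rw [ENNReal.inv_mul_le_iff (by exact_mod_cast (add_pos_of_pos_of_nonneg h1 zero_le).ne')
        ENNReal.coe_ne_top]
      refine (X.strongConst_le_mixedConst A hp.le hq one_lt_two).trans ?_
      gcongr
      exact ENNReal.coe_le_coe.2 le_self_add
    -- As `q < p` on a probability space, the mixed constant is at most the strong one for `p`,
    -- which is extrapolated from exponent `2`.
    · refine (X.mixedConst_le_strongConst A hp.le hqp.le).trans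
        ((X.strongConst_le_strongConst A one_le_two hp).trans ?_)
      gcongr
      exact ENNReal.coe_le_coe.2 le_add_self
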